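/- Let $\Theta\subset\mathbb R^p$ be nonempty, open and connected, let $\mathcal A_\theta:\mathbb R^n\rightrightarrows\mathbb R^n$ and $\mathcal B_\theta:\mathbb R^n\to\mathbb R^n$ ($\theta\in\Theta$) be given, and let $\gamma>0$. Assume: (i) for every $\theta\in\Theta$, $\mathcal A_\theta$ is maximal monotone, $\mathcal B_\theta$ is maximal monotone and locally Lipschitz, and the inclusion $0\in\mathcal A_\theta(x)+\mathcal B_\theta(x)$ has at least one solution; (ii) the maps $T(\theta,x):=\mathcal R_{\gamma\mathcal A_\theta}(x)=(\mathrm{Id}+\gamma\mathcal A_\theta)^{-1}(x)$ and $\mathcal B(\theta,x):=\mathcal B_\theta(x)$ are locally Lipschitz and path differentiable jointly in $(\theta,x)\in\Theta\times\mathbb R^n$; (iii) there are constants $\alpha,\beta>0$, independent of $\theta$, such that $\mathcal B_\theta$ is $\beta$-Lipschitz for every $\theta\in\Theta$, and either $\mathcal A_\theta$ is $\alpha$-strongly monotone for every $\theta\in\Theta$, or $\mathcal B_\theta$ is $\alpha$-strongly monotone for every $\theta\in\Theta$. Here a conservative Jacobian of a locally Lipschitz map $f$ on an open set $U$ is a set-valued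 map $\mathcal J$ from $U$ to matrices that has nonempty values, is locally bounded, has a graph closed relative to $U$, and satisfies, for every absolutely continuous curve $c:[0,1]\to U$ and almost every $t\in[0,1]$, $\frac{d}{dt}f(c(t))=L\,\dot c(t)$ for all $L\in\mathcal J(c(t))$; $f$ is path differentiable on $U$ if it is locally Lipschitz there and admits a conservative Jacobian on $U$. The Clarke Jacobian $\mathrm{Jac}^c_f(x)$ is the convex hull of all limits of Jacobians of $f$ along sequences of differentiability points converging to $x$. Suppose $\gamma\in\left(0,\frac{2\alpha}{(\alpha+\beta)^2}\right)$. Then the residual equation $x-\mathcal R_{\gamma\mathcal A_\theta}(x-\gamma\mathcal B_\theta(x))=0$ is contractive: for every $\theta\in\Theta$ there is a solution $x^\star(\theta)$ of the inclusion such that $$\sup\left\{\|V(\mathrm{Id}_n-\gamma Z)\|_{\mathrm{op}} : [U\ V]\in\mathrm{Jac}^c_T(\theta,x^\star(\theta)-\gamma\mathcal B_\theta(x^\star(\theta))),\ [W\ Z]\in\mathrm{Jac}^c_{\mathcal B}(\theta,x^\star(\theta))\right\}<1 .$$ Moreover, for every $\theta\in\Theta$ the solution $x^\star(\theta)$ is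 unique, the map $x^\star$ is path differentiable on $\Theta$, all the matrices $\mathrm{Id}_n-V(\mathrm{Id}_n-\gamma Z)$ below are invertible, and $$\mathcal J_{x^\star}(\theta)=\left\{\left(\mathrm{Id}_n-V(\mathrm{Id}_n-\gamma Z)\right)^{-1}(U-\gamma VW) : [U\ V]\in\mathrm{Jac}^c_T(\theta,x^\star(\theta)-\gamma\mathcal B_\theta(x^\star(\theta))),\ [W\ Z]\in\mathrm{Jac}^c_{\mathcal B}(\theta,x^\star(\theta))\right\}$$ is a conservative Jacobian of $x^\star$ on $\Theta$. -/

import Mathlib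

open Set Filter Topology MeasureTheory
open scoped ENNReal

namespace MonoIncl

section Calculus

variable {E F : Type*} [NormedAddCommGroup E] [NormedSpace ℝ E]
  [NormedAddCommGroup F] [NormedSpace ℝ F]

/-- The Clarke Jacobian of `f` at `x`: the convex hull of all limits of classical Jacobians of `f`
along sequences of differentiability points of `f` that converge to `x`. Jacobians are represented
as continuous linear maps. Only the values of `f` near `x` matter. -/
def clarkeJacobian (f : E → F) (x : E) : Set (E →L[ℝ] F) :=
  convexHull ℝ {L : E →L[ℝ] F | ∃ u : ℕ → E, (∀ k, DifferentiableAt ℝ f (u k)) ∧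
    Tendsto u atTop (𝓝 x) ∧ Tendsto (fun k => fderiv ℝ f (u k)) atTop (𝓝 L)}

/-- `J` is a conservative Jacobian on the (open) set `U` for the map `f`: it has nonempty values, is
locally bounded, has a graph that is closed relative to `U`, and satisfies the chain rule
`d/dt f(c(t)) = L (c'(t))` for all `L ∈ J (c t)`, for almost every `t ∈ [0, 1]`, along every
absolutely continuous curve `c : [0, 1] → U` (such a curve has a derivative at almost every `t`). -/
structure IsConservativeJacobianOn (J : E → Set (E →L[ℝ] F)) (f : E → F) (U : Set E) : Prop where
  nonempty : ∀ x ∈ U, (J x).Nonempty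
  locallyBounded : ∀ x ∈ U, ∃ C : ℝ, ∀ᶠ y in 𝓝[U] x, ∀ L ∈ J y, ‖L‖ ≤ C
  graphClosed : ∀ x ∈ U, ∀ L : E →L[ℝ] F,
    (x, L) ∈ closure {q : E × (E →L[ℝ] F) | q.1 ∈ U ∧ q.2 ∈ J q.1} → L ∈ J x
  chainRule : ∀ c : ℝ → E, AbsolutelyContinuousOnInterval c 0 1 → MapsTo c (Icc 0 1) U →
    ∀ᵐ t ∂(volume.restrict (Icc (0 : ℝ) 1)), ∀ L ∈ J (c t),
      HasDerivAt (fun s => f (c s)) (L (deriv c t)) t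

/-- `f` is path differentiable on the (open) set `U`: it is locally Lipschitz on `U` and admits a
conservative Jacobian there. -/
def PathDifferentiableOn (f : E → F) (U : Set E) : Prop :=
  LocallyLipschitzOn U f ∧
    ∃ J : E → Set (E →L[ℝ] F), IsConservativeJacobianOn J f U

end Calculus

section Monotone

variable {F : Type*} [NormedAddCommGroup F] [InnerProductSpace ℝ F]

/-- The set-valued operator `A` satisfies `⟪u - v, x - y⟫ ≥ α ‖x - y‖²` on its graph: this is
`α`-strong monotonicity for `α > 0` and monotonicity for `α = 0`. -/
def MonotoneWith (α : ℝ) (A : F → Set F) : Prop :=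
  ∀ x y u v : F, u ∈ A x → v ∈ A y → α * ‖x - y‖ ^ 2 ≤ inner ℝ (u - v) (x - y)

/-- `A` is maximal monotone: it is monotone, and no monotone operator has a larger graph. -/
def IsMaximalMonotone (A : F → Set F) : Prop :=
  MonotoneWith 0 A ∧
    ∀ A' : F → Set F, MonotoneWith 0 A' → (∀ x, A x ⊆ A' x) → ∀ x, A' x ⊆ A x

/-- A single-valued map regarded as a set-valued operator. -/
def singleValued (B : F → F) : F → Set F := fun x => {B x}

/-- The multiple `γ A` of a set-valued operator. -/
def scaled (γ : ℝ) (A : F → Set F) : F → Set F := fun x => {w | ∃ u ∈ A x, w = γ • u}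

/-- The resolvent `(Id + A)⁻¹` as a function: a point `x` with `y ∈ x + A x`, which exists and is
unique for every `y` if `A` is maximal monotone on a finite-dimensional space. (If no such point
existed, the value would be arbitrary.) -/
noncomputable def resolventFun (A : F → Set F) (y : F) : F :=
  Classical.epsilon fun x => ∃ u ∈ A x, x + u = y

end Monotone

section Inclusion

variable {E F : Type*} [NormedAddCommGroup E] [NormedSpace ℝ E]
  [NormedAddCommGroup F] [InnerProductSpace ℝ F]

/-- The solution set of `0 ∈ A_θ(x) + B_θ(x)`. -/
def solutionSet (A : E → F → Set F) (B : E → F → F) (θ : E) : Set F :=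
  {x | ∃ u ∈ A θ x, u + B θ x = 0}

/-- The map `T(θ, x) = R_{γ A_θ}(x)`. -/
noncomputable def resolventMap (γ : ℝ) (A : E → F → Set F) : E × F → F :=
  fun z => resolventFun (scaled γ (A z.1)) z.2

/-- `B` as a map of the joint variable `(θ, x)`. -/
def jointMap (B : E → F → F) : E × F → F := fun z => B z.1 z.2

/-- The standing assumption on the parametric inclusion `0 ∈ A_θ(x) + B_θ(x)`, for the step
size `γ`. -/
structure StandingAssumption (Θ : Set E) (A : E → F → Set F) (B : E → F → F) (γ : ℝ) : Prop where
  isOpen : IsOpen Θ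
  isConnected : IsConnected Θ
  gamma_pos : 0 < γ
  maximalMonotone_A : ∀ θ ∈ Θ, IsMaximalMonotone (A θ)
  maximalMonotone_B : ∀ θ ∈ Θ, IsMaximalMonotone (singleValued (B θ))
  locallyLipschitz_B : ∀ θ ∈ Θ, LocallyLipschitz (B θ)
  solution_nonempty : ∀ θ ∈ Θ, (solutionSet A B θ).Nonempty
  pathDifferentiable_T : PathDifferentiableOn (resolventMap γ A) (Θ ×ˢ univ)
  pathDifferentiable_B : PathDifferentiableOn (jointMap B) (Θ ×ˢ univ)

/-- The block `U` of `[U V]`. -/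
noncomputable def blockθ (D : E × F →L[ℝ] F) : E →L[ℝ] F :=
  D.comp (ContinuousLinearMap.inl ℝ E F)

/-- The block `V` of `[U V]`. -/
noncomputable def blockx (D : E × F →L[ℝ] F) : F →L[ℝ] F :=
  D.comp (ContinuousLinearMap.inr ℝ E F)

/-- The matrix `V (Id - γ Z)` for `D = [U V]` and `K = [W Z]`. -/
noncomputable def partialx (γ : ℝ) (D K : E × F →L[ℝ] F) : F →L[ℝ] F :=
  (blockx D).comp (ContinuousLinearMap.id ℝ F - γ • blockx K)

/-- The matrix `U - γ V W` for `D = [U V]` and `K = [W Z]`. -/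
noncomputable def partialθ (γ : ℝ) (D K : E × F →L[ℝ] F) : E →L[ℝ] F :=
  blockθ D - γ • (blockx D).comp (blockθ K)

/-- The Clarke Jacobian of `T` at `(θ, x - γ B_θ(x))`. -/
noncomputable def jacT (γ : ℝ) (A : E → F → Set F) (B : E → F → F) (θ : E) (x : F) :
    Set (E × F →L[ℝ] F) :=
  clarkeJacobian (resolventMap γ A) (θ, x - γ • B θ x)

/-- The Clarke Jacobian of `B` at `(θ, x)`. -/
def jacB (B : E → F → F) (θ : E) (x : F) : Set (E × F →L[ℝ] F) :=
  clarkeJacobian (jointMap B) (θ, x)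

/-- The conservative Jacobian with respect to `x` of the forward-backward map
`H(θ, x) = R_{γ A_θ}(x - γ B_θ(x))`, obtained from the Clarke Jacobians of `T` and `B`. -/
def jacxH (γ : ℝ) (A : E → F → Set F) (B : E → F → F) (θ : E) (x : F) : Set (F →L[ℝ] F) :=
  {M | ∃ D ∈ jacT γ A B θ x, ∃ K ∈ jacB B θ x, M = partialx γ D K}

/-- The residual equation `x - H(θ, x) = 0` is contractive on `Θ`: for each `θ ∈ Θ` there is a
solution at which the supremum of the operator norms of the elements of the conservative Jacobian of
`H` with respect to `x` is less than one. -/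
def ResidualContractive (Θ : Set E) (γ : ℝ) (A : E → F → Set F) (B : E → F → F) : Prop :=
  ∀ θ ∈ Θ, ∃ x ∈ solutionSet A B θ, (⨆ M ∈ jacxH γ A B θ x, ‖M‖ₑ) < 1

/-- The set `{(Id - V (Id - γ Z))⁻¹ (U - γ V W)}`, with `[U V]` in the Clarke Jacobian of `T` at
`(θ, xs θ - γ B_θ(xs θ))` and `[W Z]` in the Clarke Jacobian of `B` at `(θ, xs θ)`. -/
def solutionJacobian (γ : ℝ) (A : E → F → Set F) (B : E → F → F) (xs : E → F) (θ : E) :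
    Set (E →L[ℝ] F) :=
  {M | ∃ D ∈ jacT γ A B θ (xs θ), ∃ K ∈ jacB B θ (xs θ),
    M = (ContinuousLinearMap.id ℝ F - partialx γ D K).inverse.comp (partialθ γ D K)}

end Inclusion

end MonoIncl

namespace MonoIncl

section ConvexHull

/-- Carathéodory's theorem with a fixed number of points. -/
theorem exists_stdSimplex_of_mem_convexHull {V : Type*} [AddCommGroup V] [Module ℝ V]
    [FiniteDimensional ℝ V] {s : Set V} {x : V} (hx : x ∈ convexHull ℝ s) :
    ∃ w ∈ stdSimplex ℝ (Fin (Module.finrank ℝ V + 1)),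
      ∃ z : Fin (Module.finrank ℝ V + 1) → V, (∀ i, z i ∈ s) ∧ ∑ i, w i • z i = x := by
  obtain ⟨ι, hι, z, w, hz, hind, hw, hw1, hx⟩ := eq_pos_convex_span_of_mem_convexHull hx
  have hcard : Fintype.card ι ≤ Fintype.card (Fin (Module.finrank ℝ V + 1)) := by
    rw [Fintype.card_fin]
    exact hind.card_le_finrank_succ.trans (Nat.succ_le_succ (Submodule.finrank_le _))
  obtain ⟨e⟩ := Function.Embedding.nonempty_of_card_le hcard
  have hne : Nonempty ι := by
    by_contra h
    rw [not_nonempty_iff] at h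
    simp at hw1
  obtain ⟨i₀⟩ := hne
  have hwe (i : ι) : Function.extend e w 0 (e i) = w i := e.injective.extend_apply _ _ _
  have hze (i : ι) : Function.extend e z (fun _ => z i₀) (e i) = z i :=
    e.injective.extend_apply _ _ _
  have hw0 (j) (hj : j ∉ range e) : Function.extend e w 0 j = 0 :=
    Function.extend_apply' _ _ _ hj
  refine ⟨Function.extend e w 0, ⟨fun j => ?_, ?_⟩, Function.extend e z (fun _ => z i₀),
    fun j => ?_, ?_⟩
  · by_cases hj : j ∈ range e
    · obtain ⟨i, rfl⟩ := hj
      rw [hwe]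
      exact (hw i).le
    · rw [hw0 j hj]
  · rw [← hw1]
    exact (Fintype.sum_of_injective e e.injective _ _ hw0 fun i => (hwe i).symm).symm
  · by_cases hj : j ∈ range e
    · obtain ⟨i, rfl⟩ := hj
      rw [hze]
      exact hz (mem_range_self i)
    · rw [Function.extend_apply' _ _ _ hj]
      exact hz (mem_range_self i₀)
  · rw [← hx]
    refine (Fintype.sum_of_injective e e.injective _ _ (fun j hj => ?_) fun i => ?_).symm
    · rw [hw0 j hj, zero_smul]
    · rw [hwe, hze]

/-- The fibrewise convex hull of a compact set is compact. -/
theorem isCompact_fiberwise_convexHull {X V : Type*} [TopologicalSpace X] [T2Space X]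
    [NormedAddCommGroup V] [NormedSpace ℝ V] [FiniteDimensional ℝ V] {Γ : Set (X × V)}
    (hΓ : IsCompact Γ) :
    IsCompact {q : X × V | q.2 ∈ convexHull ℝ {L | (q.1, L) ∈ Γ}} := by
  set N := Module.finrank ℝ V + 1
  let S : Set (X × (Fin N → ℝ) × (Fin N → V)) :=
    {p | p.2.1 ∈ stdSimplex ℝ (Fin N) ∧ ∀ i, (p.1, p.2.2 i) ∈ Γ}
  have hSc : IsClosed S := by
    refine IsClosed.inter ?_ ?_
    · exact (isCompact_stdSimplex ℝ (Fin N)).isClosed.preimage (by fun_prop)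
    · have h : {p : X × (Fin N → ℝ) × (Fin N → V) | ∀ i, (p.1, p.2.2 i) ∈ Γ} =
          ⋂ i, (fun p : X × (Fin N → ℝ) × (Fin N → V) => (p.1, p.2.2 i)) ⁻¹' Γ := by
        ext p
        simp
      have hc : IsClosed {p : X × (Fin N → ℝ) × (Fin N → V) | ∀ i, (p.1, p.2.2 i) ∈ Γ} := by
        rw [h]
        exact isClosed_iInter fun i => hΓ.isClosed.preimage (by fun_prop)
      exact hc
  have hS : IsCompact S := by
    refine ((hΓ.image continuous_fst).prod ((isCompact_stdSimplex ℝ (Fin N)).prod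
      (isCompact_univ_pi fun _ => hΓ.image continuous_snd))).of_isClosed_subset hSc ?_
    rintro ⟨x, w, z⟩ ⟨hw, hz⟩
    refine ⟨⟨_, hz ⟨0, by omega⟩, rfl⟩, hw, fun i _ => ⟨_, hz i, rfl⟩⟩
  have himg : {q : X × V | q.2 ∈ convexHull ℝ {L | (q.1, L) ∈ Γ}} =
      (fun p : X × (Fin N → ℝ) × (Fin N → V) => (p.1, ∑ i, p.2.1 i • p.2.2 i)) '' S := by
    ext ⟨x, L⟩
    constructor
    · intro h
      obtain ⟨w, hw, z, hz, h⟩ := exists_stdSimplex_of_mem_convexHull h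
      exact ⟨(x, w, z), ⟨hw, hz⟩, Prod.ext rfl h⟩
    · rintro ⟨⟨y, w, z⟩, ⟨hw, hz⟩, h⟩
      simp only [Prod.mk.injEq] at h
      obtain ⟨rfl, rfl⟩ := h
      exact (convex_convexHull ℝ _).sum_mem (fun i _ => hw.1 i) hw.2
        fun i _ => subset_convexHull ℝ _ (hz i)
  rw [himg]
  exact hS.image (by fun_prop)

end ConvexHull

section LocallyCompactGraph

variable {E V : Type*} [NormedAddCommGroup E] [NormedAddCommGroup V]

/-- The graph of the set-valued map `J` is locally compact over `U`, in the strong sense that its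
restrictions to small closed balls centred in `U` are compact. -/
def HasLocallyCompactGraphOn (J : E → Set V) (U : Set E) : Prop :=
  ∀ x ∈ U, ∃ r > 0, Metric.closedBall x r ⊆ U ∧
    IsCompact {q : E × V | q.1 ∈ Metric.closedBall x r ∧ q.2 ∈ J q.1}

variable {J : E → Set V} {U : Set E}

theorem HasLocallyCompactGraphOn.exists_bound (hJ : HasLocallyCompactGraphOn J U) {x : E}
    (hx : x ∈ U) : ∃ C : ℝ, ∀ᶠ y in 𝓝 x, ∀ L ∈ J y, ‖L‖ ≤ C := by
  obtain ⟨r, hr, -, hc⟩ := hJ x hx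
  obtain ⟨C, hC⟩ := (hc.image continuous_snd).isBounded.exists_norm_le
  refine ⟨C, ?_⟩
  filter_upwards [Metric.closedBall_mem_nhds x hr] with y hy L hL
  exact hC L ⟨(y, L), ⟨hy, hL⟩, rfl⟩

theorem HasLocallyCompactGraphOn.mem_of_mem_closure (hJ : HasLocallyCompactGraphOn J U) {x : E}
    (hx : x ∈ U) {L : V} (h : (x, L) ∈ closure {q : E × V | q.1 ∈ U ∧ q.2 ∈ J q.1}) :
    L ∈ J x := by
  obtain ⟨r, hr, -, hc⟩ := hJ x hx
  have hmem : (x, L) ∈ closure {q : E × V | q.1 ∈ Metric.closedBall x r ∧ q.2 ∈ J q.1} := by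
    rw [mem_closure_iff_frequently] at h ⊢
    have hev : ∀ᶠ q : E × V in 𝓝 (x, L), q.1 ∈ Metric.closedBall x r :=
      continuous_fst.continuousAt.eventually (Metric.closedBall_mem_nhds x hr)
    exact (h.and_eventually hev).mono fun q hq => ⟨hq.2, hq.1.2⟩
  rw [hc.isClosed.closure_eq] at hmem
  exact hmem.2

theorem HasLocallyCompactGraphOn.convexHull [NormedSpace ℝ V] [FiniteDimensional ℝ V]
    (hJ : HasLocallyCompactGraphOn J U) :
    HasLocallyCompactGraphOn (fun x => convexHull ℝ (J x)) U := by
  intro x hx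
  obtain ⟨r, hr, hU, hc⟩ := hJ x hx
  refine ⟨r, hr, hU, ?_⟩
  convert isCompact_fiberwise_convexHull hc using 1
  ext ⟨y, L⟩
  by_cases hy : y ∈ Metric.closedBall x r
  · simp only [mem_ofPred_eq, hy, true_and]; rfl
  · simp only [mem_ofPred_eq, hy, false_and, ofPred_false, convexHull_empty, mem_empty_iff_false]

theorem HasLocallyCompactGraphOn.isClosed (hJ : HasLocallyCompactGraphOn J U) {x : E}
    (hx : x ∈ U) : IsClosed (J x) := by
  refine isClosed_of_closure_subset fun L hL => hJ.mem_of_mem_closure hx ?_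
  exact closure_mono (s := Prod.mk x '' J x) (by rintro _ ⟨M, hM, rfl⟩; exact ⟨hx, hM⟩)
    (image_closure_subset_closure_image (by fun_prop) (mem_image_of_mem _ hL))

/-- A closed condition that fails on the whole fibre over `x` fails over all nearby points. -/
theorem HasLocallyCompactGraphOn.eventually_forall_notMem (hJ : HasLocallyCompactGraphOn J U)
    {x : E} (hx : x ∈ U) {C : Set V} (hC : IsClosed C) (h : ∀ L ∈ J x, L ∉ C) :
    ∀ᶠ y in 𝓝 x, ∀ L ∈ J y, L ∉ C := by
  obtain ⟨r, hr, -, hc⟩ := hJ x hx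
  have hK : IsCompact (Prod.fst ''
      ({q : E × V | q.1 ∈ Metric.closedBall x r ∧ q.2 ∈ J q.1} ∩ Prod.snd ⁻¹' C)) :=
    (hc.inter_right (hC.preimage continuous_snd)).image continuous_fst
  have hxK : x ∈ (Prod.fst ''
      ({q : E × V | q.1 ∈ Metric.closedBall x r ∧ q.2 ∈ J q.1} ∩ Prod.snd ⁻¹' C))ᶜ := by
    rintro ⟨⟨y, L⟩, ⟨⟨-, hL⟩, hLC⟩, rfl⟩
    exact h L hL hLC
  filter_upwards [hK.isClosed.isOpen_compl.mem_nhds hxK, Metric.closedBall_mem_nhds x hr]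
    with y hy hyr L hL hLC
  exact hy ⟨(y, L), ⟨⟨hyr, hL⟩, hLC⟩, rfl⟩

end LocallyCompactGraph

section Clarke

variable {E F : Type*} [NormedAddCommGroup E] [NormedSpace ℝ E] [FiniteDimensional ℝ E]
  [NormedAddCommGroup F] [NormedSpace ℝ F] [FiniteDimensional ℝ F]

/-- The graph of the classical derivative of `f`. -/
def derivGraph (f : E → F) : Set (E × (E →L[ℝ] F)) :=
  {q | DifferentiableAt ℝ f q.1 ∧ q.2 = fderiv ℝ f q.1}

omit [FiniteDimensional ℝ E] [FiniteDimensional ℝ F] in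
theorem clarkeJacobian_eq (f : E → F) (x : E) :
    clarkeJacobian f x = convexHull ℝ {L | (x, L) ∈ closure (derivGraph f)} := by
  unfold clarkeJacobian
  congr 1
  ext L
  simp only [mem_ofPred_eq, mem_closure_iff_seq_limit]
  constructor
  · rintro ⟨u, hu, hux, huL⟩
    exact ⟨fun k => (u k, fderiv ℝ f (u k)), fun k => ⟨hu k, rfl⟩, hux.prodMk_nhds huL⟩
  · rintro ⟨q, hq, hlim⟩
    rw [nhds_prod_eq, tendsto_prod_iff'] at hlim
    refine ⟨fun k => (q k).1, fun k => (hq k).1, hlim.1, hlim.2.congr fun k => (hq k).2⟩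

omit [NormedSpace ℝ E] [NormedSpace ℝ F] [FiniteDimensional ℝ E] [FiniteDimensional ℝ F] in
theorem exists_lipschitzOnWith_closedBall {f : E → F} {U : Set E} (hU : IsOpen U)
    (hf : LocallyLipschitzOn U f) {x : E} (hx : x ∈ U) :
    ∃ K, ∃ r > 0, Metric.closedBall x r ⊆ U ∧ LipschitzOnWith K f (Metric.closedBall x r) := by
  obtain ⟨K, t, ht, hK⟩ := hf hx
  rw [hU.nhdsWithin_eq hx] at ht
  obtain ⟨r, hr, hrt⟩ := Metric.nhds_basis_closedBall.mem_iff.1 (inter_mem ht (hU.mem_nhds hx))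
  exact ⟨K, r, hr, fun y hy => (hrt hy).2, hK.mono fun y hy => (hrt hy).1⟩

theorem hasLocallyCompactGraphOn_closure_derivGraph {f : E → F} {U : Set E} (hU : IsOpen U)
    (hf : LocallyLipschitzOn U f) :
    HasLocallyCompactGraphOn (fun x => {L | (x, L) ∈ closure (derivGraph f)}) U := by
  intro x hx
  obtain ⟨K, r, hr, hrU, hK⟩ := exists_lipschitzOnWith_closedBall hU hf hx
  refine ⟨r / 2, by positivity, (Metric.closedBall_subset_closedBall (by linarith)).trans hrU, ?_⟩
  refine ((isCompact_closedBall x (r / 2)).prod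
    (isCompact_closedBall (0 : E →L[ℝ] F) K)).of_isClosed_subset
    ((Metric.isClosed_closedBall.preimage continuous_fst).inter isClosed_closure) ?_
  rintro ⟨y, L⟩ ⟨hy, hL⟩
  refine ⟨hy, ?_⟩
  have hclosed : IsClosed {q : E × (E →L[ℝ] F) | ‖q.2‖ ≤ K} :=
    isClosed_le (by fun_prop) continuous_const
  have hyr : y ∈ Metric.ball x r := by
    simp only [Metric.mem_closedBall, Metric.mem_ball] at hy ⊢
    linarith
  have hev : ∀ᶠ q : E × (E →L[ℝ] F) in 𝓝 (y, L), q.1 ∈ Metric.ball x r :=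
    continuous_fst.continuousAt.eventually (Metric.isOpen_ball.mem_nhds hyr)
  have hmem : (y, L) ∈ closure {q : E × (E →L[ℝ] F) | ‖q.2‖ ≤ K} := by
    rw [mem_closure_iff_frequently]
    refine ((mem_closure_iff_frequently.1 hL).and_eventually hev).mono ?_
    rintro ⟨z, M⟩ ⟨⟨-, hM⟩, hz⟩
    simp only at hM hz
    simp only [mem_ofPred_eq, hM]
    exact norm_fderiv_le_of_lipschitzOn ℝ
      (mem_of_superset (Metric.isOpen_ball.mem_nhds hz) Metric.ball_subset_closedBall) hK
  rw [hclosed.closure_eq] at hmem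
  simpa using hmem

theorem hasLocallyCompactGraphOn_clarkeJacobian {f : E → F} {U : Set E} (hU : IsOpen U)
    (hf : LocallyLipschitzOn U f) : HasLocallyCompactGraphOn (clarkeJacobian f) U := by
  have := (hasLocallyCompactGraphOn_closure_derivGraph hU hf).convexHull
  simpa only [← clarkeJacobian_eq] using this

theorem clarkeJacobian_nonempty {f : E → F} {U : Set E} (hU : IsOpen U)
    (hf : LocallyLipschitzOn U f) {x : E} (hx : x ∈ U) : (clarkeJacobian f x).Nonempty := by
  borelize E
  obtain ⟨K, r, hr, hrU, hK⟩ := exists_lipschitzOnWith_closedBall hU hf hx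
  have hdense : Dense {y | y ∈ Metric.ball x r → DifferentiableAt ℝ f y} := by
    refine Measure.dense_of_ae (μ := Measure.addHaar) ?_
    filter_upwards [(hK.mono Metric.ball_subset_closedBall).ae_differentiableWithinAt_of_mem
      (μ := Measure.addHaar)] with y hy hyr
    exact (hy hyr).differentiableAt (Metric.isOpen_ball.mem_nhds hyr)
  obtain ⟨u, hu, hux⟩ := mem_closure_iff_seq_limit.1 (hdense x)
  obtain ⟨N, hN⟩ := eventually_atTop.1 (hux.eventually (Metric.ball_mem_nhds x hr))
  have hd (k : ℕ) : DifferentiableAt ℝ f (u (k + N)) := hu _ (hN _ (by omega))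
  have hux' : Tendsto (fun k => u (k + N)) atTop (𝓝 x) := (tendsto_add_atTop_iff_nat N).2 hux
  have hb (k : ℕ) : fderiv ℝ f (u (k + N)) ∈ Metric.closedBall (0 : E →L[ℝ] F) K := by
    rw [mem_closedBall_zero_iff]
    exact norm_fderiv_le_of_lipschitzOn ℝ (mem_of_superset
      (Metric.isOpen_ball.mem_nhds (hN _ (by omega))) Metric.ball_subset_closedBall) hK
  obtain ⟨L, -, φ, hφ, hL⟩ := (isCompact_closedBall (0 : E →L[ℝ] F) (K : ℝ)).tendsto_subseq hb
  exact ⟨L, subset_convexHull ℝ _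
    ⟨fun k => u (φ k + N), fun k => hd _, hux'.comp hφ.tendsto_atTop, hL⟩⟩

theorem IsConservativeJacobianOn.hasLocallyCompactGraphOn {J : E → Set (E →L[ℝ] F)} {f : E → F}
    {U : Set E} (hU : IsOpen U) (hJ : IsConservativeJacobianOn J f U) :
    HasLocallyCompactGraphOn J U := by
  intro x hx
  obtain ⟨C, hC⟩ := hJ.locallyBounded x hx
  rw [hU.nhdsWithin_eq hx] at hC
  obtain ⟨r, hr, hrC⟩ := Metric.nhds_basis_closedBall.mem_iff.1 (inter_mem hC (hU.mem_nhds hx))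
  refine ⟨r, hr, fun y hy => (hrC hy).2, ?_⟩
  refine ((isCompact_closedBall x r).prod
    (isCompact_closedBall (0 : E →L[ℝ] F) C)).of_isClosed_subset ?_ ?_
  · refine isClosed_of_closure_subset ?_
    rintro ⟨y, L⟩ hL
    have hy : y ∈ Metric.closedBall x r := by
      have := closure_mono (t := Prod.fst ⁻¹' Metric.closedBall x r) (fun q hq => hq.1) hL
      rwa [(Metric.isClosed_closedBall.preimage continuous_fst).closure_eq] at this
    exact ⟨hy, hJ.graphClosed y (hrC hy).2 L
      (closure_mono (t := {q : E × (E →L[ℝ] F) | q.1 ∈ U ∧ q.2 ∈ J q.1})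
        (fun q hq => ⟨(hrC hq.1).2, hq.2⟩) hL)⟩
  · rintro ⟨y, L⟩ ⟨hy, hL⟩
    exact ⟨hy, mem_closedBall_zero_iff.2 ((hrC hy).1 L hL)⟩

end Clarke

section BlowUp

open scoped NNReal

variable {E : Type*} [NormedAddCommGroup E] [NormedSpace ℝ E]

theorem lineDeriv_rescale (g : E → ℝ) (u z v : E) {t : ℝ} (ht : t ≠ 0) :
    lineDeriv ℝ (fun z => t⁻¹ * (g (u + t • z) - g u)) z v = lineDeriv ℝ g (u + t • z) v := by
  have h1 : (fun s : ℝ => t⁻¹ * (g (u + t • (z + s • v)) - g u)) =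
      fun s => t⁻¹ * ((fun τ : ℝ => g (u + t • z + τ • v)) (t * s) - g u) := by
    funext s
    simp only [smul_add, smul_smul, add_assoc]
  unfold lineDeriv
  rw [h1, deriv_const_mul_field, deriv_sub_const,
    deriv_comp_mul_left t (fun τ : ℝ => g (u + t • z + τ • v)) 0, mul_zero, smul_eq_mul,
    inv_mul_cancel_left₀ ht]

theorem lipschitzWith_rescale {g : E → ℝ} {C : ℝ≥0} (hg : LipschitzWith C g) (u : E) {t : ℝ}
    (ht : t ≠ 0) : LipschitzWith C (fun z => t⁻¹ * (g (u + t • z) - g u)) := by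
  refine LipschitzWith.of_dist_le_mul fun z w => ?_
  have h := hg.dist_le_mul (u + t • z) (u + t • w)
  rw [dist_add_left, dist_smul₀] at h
  rw [Real.dist_eq] at h ⊢
  rw [← mul_sub, sub_sub_sub_cancel_right, abs_mul, abs_inv, inv_mul_le_iff₀ (abs_pos.2 ht)]
  rw [Real.norm_eq_abs] at h
  linarith

variable [FiniteDimensional ℝ E] [MeasurableSpace E] [BorelSpace E]
  {μ : Measure E} [μ.IsAddHaarMeasure]

omit [FiniteDimensional ℝ E] in
theorem tendsto_integral_rescale {g ρ : E → ℝ} {C : ℝ≥0} (hg : LipschitzWith C g)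
    {g' : E →L[ℝ] ℝ} {u : E} (hg' : HasFDerivAt g g' u) (hρ : Continuous ρ)
    (hρc : HasCompactSupport ρ) :
    Tendsto (fun t : ℝ => ∫ z, ρ z * (t⁻¹ * (g (u + t • z) - g u)) ∂μ) (𝓝[>] 0)
      (𝓝 (∫ z, ρ z * g' z ∂μ)) := by
  refine tendsto_integral_filter_of_dominated_convergence (fun z => ‖ρ z‖ * (C * ‖z‖)) ?_ ?_ ?_ ?_
  · filter_upwards with t
    have := hg.continuous
    exact Continuous.aestronglyMeasurable (by fun_prop)
  · filter_upwards [self_mem_nhdsWithin] with t ht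
    filter_upwards with z
    rw [norm_mul]
    gcongr
    simpa using (lipschitzWith_rescale hg u (ne_of_gt ht)).norm_sub_le z 0
  · exact Continuous.integrable_of_hasCompactSupport (by fun_prop) hρc.norm.mul_right
  · filter_upwards with z
    refine Tendsto.const_mul _ ?_
    have := ((hg'.hasLineDerivAt z).tendsto_slope_zero).mono_left
      (nhdsWithin_mono (0 : ℝ) (s := Ioi 0) (t := {0}ᶜ) fun t (ht : 0 < t) => ne_of_gt ht)
    simpa using this

/-- A Lipschitz vector field, differentiable at `u`, whose generalized divergence is almost
everywhere at most `c` near `u`, has divergence at most `c` at `u`. -/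
theorem sum_fderiv_le_of_ae_sum_lineDeriv_le {ι : Type*} [Fintype ι] {g : ι → E → ℝ}
    {C : ι → ℝ≥0} (hg : ∀ i, LipschitzWith (C i) (g i)) {u : E} {g' : ι → E →L[ℝ] ℝ}
    (hg' : ∀ i, HasFDerivAt (g i) (g' i) u) {v : ι → E} {c r : ℝ} (hr : 0 < r)
    (h : ∀ᵐ y ∂μ, y ∈ Metric.ball u r → ∑ i, lineDeriv ℝ (g i) y (v i) ≤ c) :
    ∑ i, g' i (v i) ≤ c := by
  let b : ContDiffBump (0 : E) := ⟨1 / 2, 1, by norm_num, by norm_num⟩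
  set ρ : E → ℝ := b.normed μ with hρ
  have hρs : ContDiff ℝ 1 ρ := b.contDiff_normed
  have hρc : HasCompactSupport ρ := b.hasCompactSupport_normed
  have hρ1 : ∫ z, ρ z ∂μ = 1 := b.integral_normed
  have hρi : Integrable ρ μ := hρs.continuous.integrable_of_hasCompactSupport hρc
  obtain ⟨D, hD⟩ : ∃ D, LipschitzWith D ρ := hρs.lipschitzWith_of_hasCompactSupport hρc (by simp)
  have hline (w : E) : (fun z => lineDeriv ℝ ρ z w) = fun z => fderiv ℝ ρ z w := by
    funext z
    exact (hρs.differentiable (by simp) z).lineDeriv_eq_fderiv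
  have hlim (i : ι) : Tendsto (fun t : ℝ => ∫ z, lineDeriv ℝ
      (fun z => t⁻¹ * (g i (u + t • z) - g i u)) z (v i) * ρ z ∂μ) (𝓝[>] 0) (𝓝 (g' i (v i))) := by
    have h1 : ∫ z, lineDeriv ℝ ρ z (-v i) * g' i z ∂μ = g' i (v i) := by
      rw [← LipschitzWith.integral_lineDeriv_mul_eq (g' i).lipschitz hD hρc (v i)]
      have (z : E) : lineDeriv ℝ (g' i) z (v i) = g' i (v i) :=
        ((g' i).hasFDerivAt.hasLineDerivAt (v i)).lineDeriv
      simp only [this, integral_const_mul, hρ1, mul_one]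
    rw [← h1]
    refine (tendsto_integral_rescale (μ := μ) (hg i) (hg' i) (ρ := fun z => lineDeriv ℝ ρ z (-v i))
      ?_ ?_).congr' ?_
    · rw [hline]
      exact (hρs.continuous_fderiv (by simp)).clm_apply continuous_const
    · rw [hline]
      exact (hρc.fderiv ℝ).comp_left (g := fun L : E →L[ℝ] ℝ => L (-v i)) rfl
    · filter_upwards [self_mem_nhdsWithin] with t ht
      exact (LipschitzWith.integral_lineDeriv_mul_eq
        (lipschitzWith_rescale (hg i) u (ne_of_gt ht)) hD hρc (v i)).symm
  refine le_of_tendsto (tendsto_finsetSum _ fun i _ => hlim i) ?_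
  filter_upwards [Ioo_mem_nhdsGT hr] with t ht
  have ht0 : t ≠ 0 := ht.1.ne'
  have hint (i : ι) : Integrable (fun z => lineDeriv ℝ
      (fun z => t⁻¹ * (g i (u + t • z) - g i u)) z (v i) * ρ z) μ := by
    refine (hρi.smul_of_top_left
      ((lipschitzWith_rescale (hg i) u ht0).memLp_lineDeriv (v i))).congr ?_
    filter_upwards with z
    simp [mul_comm]
  rw [← integral_finsetSum _ fun i _ => hint i]
  have hae : ∀ᵐ z ∂μ, u + t • z ∈ Metric.ball u r →
      ∑ i, lineDeriv ℝ (g i) (u + t • z) (v i) ≤ c := by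
    have h0 := addHaar_image_eq_zero_of_differentiableOn_of_addHaar_eq_zero μ
      (f := fun y => t⁻¹ • (y - u)) (by fun_prop) (ae_iff.1 h)
    rw [ae_iff]
    refine measure_mono_null ?_ h0
    intro z hz
    exact ⟨u + t • z, hz, by simp [smul_smul, ht0]⟩
  calc ∫ z, ∑ i, lineDeriv ℝ (fun z => t⁻¹ * (g i (u + t • z) - g i u)) z (v i) * ρ z ∂μ
      ≤ ∫ z, c * ρ z ∂μ := by
        refine integral_mono_ae (integrable_finsetSum _ fun i _ => hint i) (hρi.const_mul c) ?_
        filter_upwards [hae] with z hz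
        rw [← Finset.sum_mul]
        by_cases hz1 : z ∈ Metric.ball (0 : E) 1
        · refine mul_le_mul_of_nonneg_right ?_ (b.nonneg_normed z)
          simp only [lineDeriv_rescale _ _ _ _ ht0]
          refine hz ?_
          simp only [Metric.mem_ball, dist_self_add_left, norm_smul, Real.norm_eq_abs,
            abs_of_pos ht.1, dist_zero_right] at hz1 ⊢
          nlinarith [ht.1, ht.2, norm_nonneg z]
        · have : ρ z = 0 := by
            rw [← Function.notMem_support, hρ, b.support_normed_eq]
            exact hz1
          simp [this]
    _ = c := by rw [integral_const_mul, hρ1, mul_one]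

end BlowUp

section ChainRule

variable {E F : Type*} [NormedAddCommGroup E] [NormedSpace ℝ E]
  [NormedAddCommGroup F] [NormedSpace ℝ F]
  {J : E → Set (E →L[ℝ] F)} {f : E → F} {U : Set E}

/-- A conservative Jacobian computes line derivatives at almost every point of a line. -/
theorem IsConservativeJacobianOn.ae_hasLineDerivAt_line (hU : IsOpen U)
    (hJ : IsConservativeJacobianOn J f U) (p v : E) :
    ∀ᵐ t : ℝ, p + t • v ∈ U → ∀ L ∈ J (p + t • v), HasLineDerivAt ℝ f (L v) (p + t • v) v := by
  rw [ae_iff]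
  refine measure_null_of_locally_null _ fun t₀ ht₀ => ?_
  simp only [mem_ofPred_eq, not_forall] at ht₀
  obtain ⟨hp, -⟩ := ht₀
  have hcont : Continuous fun t : ℝ => p + t • v := by fun_prop
  obtain ⟨δ, hδ, hδU⟩ := Metric.nhds_basis_closedBall.mem_iff.1
    ((hU.preimage hcont).mem_nhds hp)
  set a : ℝ → ℝ := fun s => t₀ - δ + 2 * δ * s with ha
  have had (s : ℝ) : HasDerivAt a (2 * δ) s := by
    simpa [ha] using ((hasDerivAt_id s).const_mul (2 * δ)).const_add (t₀ - δ)
  set c : ℝ → E := fun s => p + a s • v with hc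
  have hcd (s : ℝ) : HasDerivAt c ((2 * δ) • v) s := ((had s).smul_const v).const_add p
  have hcAC : AbsolutelyContinuousOnInterval c 0 1 := by
    refine LipschitzOnWith.absolutelyContinuousOnInterval
      (K := ‖(2 * δ) • v‖₊) (LipschitzWith.lipschitzOnWith ?_)
    exact lipschitzWith_of_nnnorm_deriv_le (fun s => (hcd s).differentiableAt)
      fun s => by rw [(hcd s).deriv]
  have hcU : MapsTo c (Icc 0 1) U := by
    intro s hs
    refine hδU ?_
    rw [Metric.mem_closedBall, Real.dist_eq, abs_le, ha]
    constructor <;> nlinarith [hs.1, hs.2]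
  have hae := hJ.chainRule c hcAC hcU
  rw [ae_restrict_iff' measurableSet_Icc, ae_iff] at hae
  have h0 := addHaar_image_eq_zero_of_differentiableOn_of_addHaar_eq_zero volume
    (f := a) (fun s _ => (had s).differentiableAt.differentiableWithinAt) hae
  refine ⟨_, inter_mem_nhdsWithin _ (Metric.ball_mem_nhds t₀ hδ), measure_mono_null ?_ h0⟩
  rintro t ⟨ht, htδ⟩
  have has : a ((t - t₀ + δ) / (2 * δ)) = t := by
    simp only [ha]
    field_simp
    ring
  refine ⟨(t - t₀ + δ) / (2 * δ), ?_, has⟩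
  by_contra hnot
  refine ht fun _ L hL => ?_
  replace hnot := not_not.1 hnot
  rw [Metric.mem_ball, Real.dist_eq, abs_lt] at htδ
  have hmem : (t - t₀ + δ) / (2 * δ) ∈ Icc (0 : ℝ) 1 := by
    constructor
    · exact div_nonneg (by linarith) (by linarith)
    · rw [div_le_one (by linarith)]
      linarith
  have hd := hnot hmem L (by simpa only [hc, has] using hL)
  rw [(hcd _).deriv] at hd
  set s₀ := (t - t₀ + δ) / (2 * δ) with hs₀
  have hb : HasDerivAt (fun τ : ℝ => s₀ + τ / (2 * δ)) ((2 * δ)⁻¹) 0 := by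
    simpa using ((hasDerivAt_id (0 : ℝ)).div_const (2 * δ)).const_add s₀
  have hd' : HasDerivAt (fun s => f (c s)) (L ((2 * δ) • v)) (s₀ + 0 / (2 * δ)) := by
    simpa using hd
  have hcomp := hd'.scomp 0 hb
  have hδ2 : (2 * δ) ≠ 0 := by positivity
  rw [map_smul, smul_smul, inv_mul_cancel₀ hδ2, one_smul] at hcomp
  refine hcomp.congr_of_eventuallyEq (Eventually.of_forall fun τ => ?_)
  have haτ : a (s₀ + τ / (2 * δ)) = t + τ := by
    rw [← has]
    simp only [ha]
    field_simp
    ring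
  simp only [Function.comp, hc, haτ, add_smul, add_assoc]

variable [FiniteDimensional ℝ E] [MeasurableSpace E] [BorelSpace E]
  {μ : Measure E} [μ.IsAddHaarMeasure]

theorem IsConservativeJacobianOn.ae_lineDeriv_le (hU : IsOpen U)
    (hJ : IsConservativeJacobianOn J f U) {u : E} {r : ℝ} (hrU : Metric.closedBall u r ⊆ U)
    (hc : IsCompact {q : E × (E →L[ℝ] F) | q.1 ∈ Metric.closedBall u r ∧ q.2 ∈ J q.1})
    (φ : F →L[ℝ] ℝ) {g : E → ℝ} (hg : Continuous g)
    (hgf : EqOn g (φ ∘ f) (Metric.closedBall u r)) (v : E) :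
    ∀ᵐ y ∂μ, y ∈ Metric.ball u r → ∀ L ∈ J y, lineDeriv ℝ g y v ≤ φ (L v) := by
  set S : Set E := {y | y ∈ Metric.ball u r → ∀ L ∈ J y, lineDeriv ℝ g y v ≤ φ (L v)} with hS
  have hmeas : MeasurableSet S := by
    have hSc : Sᶜ = ⋃ q : ℚ, (Metric.ball u r ∩ Prod.fst ''
        ({q : E × (E →L[ℝ] F) | q.1 ∈ Metric.closedBall u r ∧ q.2 ∈ J q.1} ∩
          {p | φ (p.2 v) ≤ q})) ∩ {y | (q : ℝ) < lineDeriv ℝ g y v} := by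
      ext y
      simp only [hS, mem_compl_iff, mem_ofPred_eq, not_forall, not_le, mem_iUnion, mem_inter_iff,
        mem_image, Prod.exists, exists_and_right, exists_eq_right]
      constructor
      · rintro ⟨hy, L, hL, hlt⟩
        obtain ⟨q, hq1, hq2⟩ := exists_rat_btwn hlt
        exact ⟨q, ⟨hy, L, ⟨Metric.ball_subset_closedBall hy, hL⟩, hq1.le⟩, hq2⟩
      · rintro ⟨q, ⟨hy, L, ⟨-, hL⟩, hq1⟩, hq2⟩
        exact ⟨hy, L, hL, hq1.trans_lt hq2⟩
    rw [← compl_compl S, hSc]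
    refine (MeasurableSet.iUnion fun q => (measurableSet_ball.inter ?_).inter
      (measurableSet_lt measurable_const (measurable_lineDeriv hg))).compl
    refine ((hc.inter_right ?_).image continuous_fst).measurableSet
    exact isClosed_le (by fun_prop) continuous_const
  refine ae_mem_of_ae_add_linearMap_mem
    ((ContinuousLinearMap.toSpanSingleton ℝ v).toLinearMap) volume μ hmeas fun p => ?_
  filter_upwards [hJ.ae_hasLineDerivAt_line hU p v] with t ht
  change p + t • v ∈ Metric.ball u r → _
  intro hy L hL
  have hd := ht (hrU (Metric.ball_subset_closedBall hy)) L hL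
  have hd' : HasLineDerivAt ℝ (φ ∘ f) (φ (L v)) (p + t • v) v :=
    φ.hasFDerivAt.comp_hasDerivAt 0 hd
  refine le_of_eq (HasLineDerivAt.lineDeriv ?_)
  refine hd'.congr_of_eventuallyEq ?_
  filter_upwards [Metric.isOpen_ball.mem_nhds hy] with z hz
  exact hgf (Metric.ball_subset_closedBall hz)

end ChainRule

section Clarke

variable {E F : Type*} [NormedAddCommGroup E] [NormedSpace ℝ E] [FiniteDimensional ℝ E]
  [NormedAddCommGroup F] [NormedSpace ℝ F] [FiniteDimensional ℝ F]
  {J : E → Set (E →L[ℝ] F)} {f : E → F} {U : Set E}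

/-- At every point of differentiability, the derivative belongs to the convex hull of any
conservative Jacobian. -/
theorem IsConservativeJacobianOn.mem_convexHull_of_hasFDerivAt (hU : IsOpen U)
    (hf : LocallyLipschitzOn U f) (hJ : IsConservativeJacobianOn J f U) {u : E} (hu : u ∈ U)
    {f' : E →L[ℝ] F} (hf' : HasFDerivAt f f' u) : f' ∈ convexHull ℝ (J u) := by
  borelize E
  by_contra hmem
  have hJc := hJ.hasLocallyCompactGraphOn hU
  obtain ⟨φ, c, hφc, hcφ⟩ := geometric_hahn_banach_closed_point (convex_convexHull ℝ (J u))
    (hJc.convexHull.isClosed hu) hmem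
  have hev : ∀ᶠ y in 𝓝 u, ∀ L ∈ J y, φ L < c := by
    have := hJc.eventually_forall_notMem hu (isClosed_le continuous_const φ.continuous)
      (C := {L | c ≤ φ L}) fun L hL => not_le.2 (hφc L (subset_convexHull ℝ _ hL))
    simpa using this
  obtain ⟨r₁, hr₁, hr₁U, hc⟩ := hJc u hu
  obtain ⟨K, r₂, hr₂, -, hK⟩ := exists_lipschitzOnWith_closedBall hU hf hu
  obtain ⟨r₃, hr₃, hr₃c⟩ := Metric.nhds_basis_closedBall.mem_iff.1 hev
  obtain ⟨r, hr, hrr₁, hrr₂, hrr₃⟩ : ∃ r > 0, r ≤ r₁ ∧ r ≤ r₂ ∧ r ≤ r₃ :=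
    ⟨min r₁ (min r₂ r₃), by positivity, by simp, by simp, by simp⟩
  have hcr : IsCompact {q : E × (E →L[ℝ] F) | q.1 ∈ Metric.closedBall u r ∧ q.2 ∈ J q.1} := by
    refine (hc.inter_right (Metric.isClosed_closedBall.preimage continuous_fst
      (t := Metric.closedBall u r))).of_isClosed_subset ?_ ?_
    · convert (hc.inter_right (Metric.isClosed_closedBall.preimage continuous_fst
        (t := Metric.closedBall u r))).isClosed using 1
      ext q
      exact ⟨fun h => ⟨⟨Metric.closedBall_subset_closedBall hrr₁ h.1, h.2⟩, h.1⟩,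
        fun h => ⟨h.2, h.1.2⟩⟩
    · exact fun q h => ⟨⟨Metric.closedBall_subset_closedBall hrr₁ h.1, h.2⟩, h.1⟩
  let b := Module.finBasis ℝ E
  let ψ (i : Fin (Module.finrank ℝ E)) : F →L[ℝ] ℝ :=
    φ.comp (ContinuousLinearMap.smulRightL ℝ E F (LinearMap.toContinuousLinearMap (b.coord i)))
  have hψ (L : E →L[ℝ] F) : φ L = ∑ i, ψ i (L (b i)) := by
    have : L = ∑ i, ContinuousLinearMap.smulRightL ℝ E F
        (LinearMap.toContinuousLinearMap (b.coord i)) (L (b i)) := by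
      ext x
      calc L x = L (∑ i, b.repr x i • b i) := by rw [b.sum_repr]
        _ = _ := by simp [-Module.Basis.sum_repr]
    conv_lhs => rw [this]
    simp only [map_sum, ψ, ContinuousLinearMap.comp_apply]
  have hext (i) : ∃ g : E → ℝ, LipschitzWith (‖ψ i‖₊ * K) g ∧
      EqOn (ψ i ∘ f) g (Metric.closedBall u r) :=
    ((ψ i).lipschitz.comp_lipschitzOnWith
      (hK.mono (Metric.closedBall_subset_closedBall hrr₂))).extend_real
  choose g hg hgf using hext
  have hg' (i) : HasFDerivAt (g i) ((ψ i).comp f') u := by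
    refine ((ψ i).hasFDerivAt.comp u hf').congr_of_eventuallyEq ?_
    filter_upwards [Metric.closedBall_mem_nhds u hr] with z hz
    exact (hgf i hz).symm
  have hle := sum_fderiv_le_of_ae_sum_lineDeriv_le (μ := Measure.addHaar) hg hg' (v := b)
    (c := c) hr ?_
  · rw [hψ] at hcφ
    exact absurd hle (not_le.2 hcφ)
  · have hae := ae_all_iff.2 fun i => hJ.ae_lineDeriv_le (μ := Measure.addHaar) hU
      ((Metric.closedBall_subset_closedBall hrr₁).trans hr₁U) hcr (ψ i) (hg i).continuous
      (hgf i).symm (b i)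
    filter_upwards [hae] with y hy hyr
    have hyr' := Metric.ball_subset_closedBall hyr
    obtain ⟨L, hL⟩ := hJ.nonempty y (hr₁U (Metric.closedBall_subset_closedBall hrr₁ hyr'))
    calc ∑ i, lineDeriv ℝ (g i) y (b i) ≤ ∑ i, ψ i (L (b i)) :=
          Finset.sum_le_sum fun i _ => hy i hyr L hL
      _ = φ L := (hψ L).symm
      _ ≤ c := (hr₃c (Metric.closedBall_subset_closedBall hrr₃ hyr') L hL).le

theorem IsConservativeJacobianOn.clarkeJacobian_subset (hU : IsOpen U)
    (hf : LocallyLipschitzOn U f) (hJ : IsConservativeJacobianOn J f U) {x : E} (hx : x ∈ U) :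
    clarkeJacobian f x ⊆ convexHull ℝ (J x) := by
  rw [clarkeJacobian_eq]
  refine convexHull_min (fun L hL => ?_) (convex_convexHull ℝ _)
  refine (hJ.hasLocallyCompactGraphOn hU).convexHull.mem_of_mem_closure hx ?_
  rw [mem_ofPred_eq, mem_closure_iff_frequently] at hL
  rw [mem_closure_iff_frequently]
  have hev : ∀ᶠ q : E × (E →L[ℝ] F) in 𝓝 (x, L), q.1 ∈ U :=
    continuous_fst.continuousAt.eventually (hU.mem_nhds hx)
  refine (hL.and_eventually hev).mono ?_
  rintro ⟨y, M⟩ ⟨⟨hy, hM⟩, hyU⟩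
  refine ⟨hyU, ?_⟩
  simp only at hM
  simp only [hM]
  exact hJ.mem_convexHull_of_hasFDerivAt hU hf hyU hy.hasFDerivAt

/-- The Clarke Jacobian of a path differentiable map is a conservative Jacobian. -/
theorem PathDifferentiableOn.isConservativeJacobianOn_clarkeJacobian (hU : IsOpen U)
    (hf : PathDifferentiableOn f U) : IsConservativeJacobianOn (clarkeJacobian f) f U := by
  obtain ⟨hlip, J, hJ⟩ := hf
  have hG := hasLocallyCompactGraphOn_clarkeJacobian hU hlip
  refine ⟨fun x hx => clarkeJacobian_nonempty hU hlip hx, fun x hx => ?_,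
    fun x hx L hL => hG.mem_of_mem_closure hx hL, fun c hc hcU => ?_⟩
  · obtain ⟨C, hC⟩ := hG.exists_bound hx
    exact ⟨C, hC.filter_mono nhdsWithin_le_nhds⟩
  · filter_upwards [hJ.chainRule c hc hcU, ae_restrict_mem measurableSet_Icc] with t ht htI L hL
    obtain ⟨M, hM⟩ := hJ.nonempty (c t) (hcU htI)
    have hMd := ht M hM
    have hsub : convexHull ℝ (J (c t)) ⊆ {L | L (deriv c t) = M (deriv c t)} := by
      refine convexHull_min (fun L hL => (ht L hL).unique hMd) ?_
      intro L₁ h₁ L₂ h₂ a b _ _ hab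
      simp only [mem_ofPred_eq] at h₁ h₂
      simp only [mem_ofPred_eq, add_apply, smul_apply,
        h₁, h₂, ← add_smul, hab, one_smul]
    have heq : L (deriv c t) = M (deriv c t) :=
      hsub (hJ.clarkeJacobian_subset hU hlip (hcU htI) hL)
    rwa [heq]

end Clarke

section Minty

variable {F : Type*} [NormedAddCommGroup F] [InnerProductSpace ℝ F]

local notation "⟪" x ", " y "⟫" => inner ℝ x y

theorem sum_mul_inner_sub_le_zero {ι : Type*} [Fintype ι] {a v : ι → F}
    (h : ∀ i j, 0 ≤ ⟪v i - v j, a i - a j⟫) {w : ι → ℝ} (hw : ∀ i, 0 ≤ w i)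
    (hw1 : ∑ i, w i = 1) {x : F} (hx : x = ∑ i, w i • a i) :
    ∑ i, w i * ⟪x + v i, x - a i⟫ ≤ 0 := by
  have hxa (i : ι) : x - a i = ∑ j, w j • (a j - a i) := by
    simp only [smul_sub, Finset.sum_sub_distrib, ← Finset.sum_smul, hw1, one_smul, hx]
  have h0 : ∑ i, w i * ⟪x, x - a i⟫ = 0 := by
    have : ∑ i, w i • (x - a i) = 0 := by
      simp only [smul_sub, Finset.sum_sub_distrib, ← Finset.sum_smul, hw1, one_smul, ← hx, sub_self]
    simp only [← inner_smul_right, ← inner_sum, this, inner_zero_right]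
  have h1 : ∑ i, w i * ⟪v i, x - a i⟫ = ∑ i, ∑ j, w i * (w j * ⟪v i, a j - a i⟫) := by
    refine Finset.sum_congr rfl fun i _ => ?_
    rw [hxa, inner_sum, Finset.mul_sum]
    simp only [inner_smul_right]
  have h2 : ∑ i, w i * ⟪v i, x - a i⟫ = ∑ i, ∑ j, w i * (w j * ⟪v j, a i - a j⟫) := by
    rw [h1, Finset.sum_comm]
    refine Finset.sum_congr rfl fun i _ => Finset.sum_congr rfl fun j _ => ?_
    ring
  have h3 : 2 * ∑ i, w i * ⟪v i, x - a i⟫ ≤ 0 := by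
    rw [two_mul]
    nth_rewrite 1 [h1]
    rw [h2, ← Finset.sum_add_distrib]
    refine Finset.sum_nonpos fun i _ => ?_
    rw [← Finset.sum_add_distrib]
    refine Finset.sum_nonpos fun j _ => ?_
    have hij := mul_nonneg (mul_nonneg (hw i) (hw j)) (h i j)
    simp only [inner_sub_left, inner_sub_right] at hij ⊢
    linarith
  simp only [inner_add_left, mul_add, Finset.sum_add_distrib, h0]
  linarith

theorem convexOn_inner_add_sub (v a : F) : ConvexOn ℝ univ fun x => ⟪x + v, x - a⟫ := by
  refine ⟨convex_univ, fun x _ y _ s t hs ht hst => ?_⟩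
  have h := mul_nonneg (mul_nonneg hs ht) (real_inner_self_nonneg (x := x - y))
  obtain rfl : t = 1 - s := by linarith
  simp only [inner_add_left, inner_sub_right, inner_sub_left, inner_add_right, inner_smul_left,
    inner_smul_right, smul_eq_mul, RCLike.conj_to_real, real_inner_comm x y] at h ⊢
  nlinarith

/-- A finite monotone relation can be extended, up to `ε`, by a point on the antidiagonal. -/
theorem exists_inner_add_sub_lt {ι : Type*} [Fintype ι] {a v : ι → F}
    (h : ∀ i j, 0 ≤ ⟪v i - v j, a i - a j⟫) {ε : ℝ} (hε : 0 < ε) :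
    ∃ x : F, ∀ i, ⟪x + v i, x - a i⟫ < ε := by
  classical
  let S : Set (ι → ℝ) := {z | ∃ x : F, ∀ i, ⟪x + v i, x - a i⟫ < z i}
  have hSo : IsOpen S := by
    have : S = ⋃ x : F, univ.pi fun i => Ioi ⟪x + v i, x - a i⟫ := by
      ext z
      simp [S]
    rw [this]
    exact isOpen_iUnion fun x => isOpen_set_pi finite_univ fun i _ => isOpen_Ioi
  have hSc : Convex ℝ S := by
    rintro z ⟨x, hx⟩ z' ⟨x', hx'⟩ s t hs ht hst
    refine ⟨s • x + t • x', fun i => ?_⟩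
    refine ((convexOn_inner_add_sub (v i) (a i)).2 (mem_univ x) (mem_univ x') hs ht hst).trans_lt ?_
    simp only [Pi.add_apply, Pi.smul_apply, smul_eq_mul]
    rcases hs.eq_or_lt with rfl | hs
    · obtain rfl : t = 1 := by linarith
      simpa using hx' i
    · exact add_lt_add_of_lt_of_le (mul_lt_mul_of_pos_left (hx i) hs)
        (mul_le_mul_of_nonneg_left (hx' i).le ht)
  by_contra hcon
  obtain ⟨l, hl⟩ := geometric_hahn_banach_open_point hSc hSo (x := fun _ => ε) hcon
  have hlz (z : ι → ℝ) : l z = ∑ i, z i * l (Pi.single i 1) := by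
    conv_lhs => rw [pi_eq_sum_univ' z]
    simp only [map_sum, map_smul, smul_eq_mul]
  have hneg (i : ι) : l (Pi.single i 1) ≤ 0 := by
    by_contra! hpos
    obtain ⟨z, hz⟩ : S.Nonempty := ⟨fun i => ⟪(0 : F) + v i, 0 - a i⟫ + 1, 0, fun i => by simp⟩
    have hlt := hl z hz
    set t := (l (fun _ => ε) - l z) / l (Pi.single i 1) with ht
    have ht0 : 0 ≤ t := div_nonneg (by linarith) hpos.le
    have hmem : z + t • Pi.single i 1 ∈ S := by
      obtain ⟨x, hx⟩ := hz
      refine ⟨x, fun j => (hx j).trans_le ?_⟩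
      simp only [Pi.add_apply, Pi.smul_apply, smul_eq_mul, le_add_iff_nonneg_right]
      refine mul_nonneg ht0 ?_
      by_cases hj : j = i
      · subst hj; simp
      · simp [hj]
    have := hl _ hmem
    rw [map_add, map_smul, smul_eq_mul, ht, div_mul_cancel₀ _ hpos.ne'] at this
    linarith
  set Λ : ℝ := ∑ i, -l (Pi.single i 1) with hΛ
  have hΛ0 : 0 ≤ Λ := Finset.sum_nonneg fun i _ => by linarith [hneg i]
  have hΛpos : 0 < Λ := by
    refine hΛ0.lt_of_ne fun h0 => ?_
    have hall := (Finset.sum_eq_zero_iff_of_nonneg fun i _ => by linarith [hneg i]).1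
      (hΛ.symm.trans h0.symm)
    have hl0 (z : ι → ℝ) : l z = 0 := by
      rw [hlz]
      refine Finset.sum_eq_zero fun i hi => ?_
      rw [neg_eq_zero.1 (hall i hi), mul_zero]
    have := hl (fun i => ⟪(0 : F) + v i, 0 - a i⟫ + 1) ⟨0, fun i => by simp⟩
    rw [hl0, hl0] at this
    exact lt_irrefl _ this
  let w : ι → ℝ := fun i => -l (Pi.single i 1) / Λ
  have hw1 : ∑ i, w i = 1 := by
    rw [← Finset.sum_div, ← hΛ, div_self hΛpos.ne']
  have hle := sum_mul_inner_sub_le_zero h (w := w)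
    (fun i => div_nonneg (by linarith [hneg i]) hΛ0) hw1 rfl
  set x := ∑ i, w i • a i
  have hlt := hl (fun i => ⟪x + v i, x - a i⟫ + ε) ⟨x, fun i => by linarith⟩
  rw [hlz, hlz (fun _ => ε)] at hlt
  have hfin : ∑ i, w i * ⟪x + v i, x - a i⟫ =
      -(∑ i, ⟪x + v i, x - a i⟫ * l (Pi.single i 1)) / Λ := by
    rw [← Finset.sum_neg_distrib, Finset.sum_div]
    exact Finset.sum_congr rfl fun i _ => by simp only [w]; ring
  rw [hfin, div_le_iff₀ hΛpos] at hle
  simp only [add_mul, Finset.sum_add_distrib] at hlt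
  linarith

variable [FiniteDimensional ℝ F]

theorem isCompact_inner_add_sub_le (v a : F) (ε : ℝ) : IsCompact {x | ⟪x + v, x - a⟫ ≤ ε} := by
  refine Metric.isCompact_of_isClosed_isBounded (isClosed_le (by fun_prop) continuous_const) ?_
  refine isBounded_iff_forall_norm_le.2 ⟨1 + ‖v‖ + ‖a‖ + ‖v‖ * ‖a‖ + |ε|, fun x hx => ?_⟩
  have h1 : ‖x‖ ^ 2 = ⟪x + v, x - a⟫ + ⟪x, a⟫ - ⟪v, x⟫ + ⟪v, a⟫ := by
    simp only [inner_add_left, inner_sub_right, real_inner_self_eq_norm_sq]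
    ring
  have h2 := real_inner_le_norm x a
  have h3 := neg_le_of_abs_le (abs_real_inner_le_norm v x)
  have h4 := real_inner_le_norm v a
  have hx' : ⟪x + v, x - a⟫ ≤ |ε| := le_trans hx (le_abs_self ε)
  by_contra! hcon
  nlinarith [norm_nonneg x, norm_nonneg v, norm_nonneg a, abs_nonneg ε,
    mul_nonneg (norm_nonneg v) (norm_nonneg a)]

/-- A monotone relation on a finite-dimensional space is monotonically related to some point of the
antidiagonal. -/
theorem exists_forall_inner_add_sub_nonpos {G : Set (F × F)}
    (hG : ∀ p ∈ G, ∀ q ∈ G, 0 ≤ ⟪p.2 - q.2, p.1 - q.1⟫) :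
    ∃ x : F, ∀ p ∈ G, ⟪x + p.2, x - p.1⟫ ≤ 0 := by
  rcases G.eq_empty_or_nonempty with rfl | ⟨p₀, hp₀⟩
  · exact ⟨0, by simp⟩
  by_contra hcon
  push Not at hcon
  have hinter : {x : F | ⟪x + p₀.2, x - p₀.1⟫ ≤ 1} ∩
      ⋂ i : G × Ioi (0 : ℝ), {x : F | ⟪x + i.1.1.2, x - i.1.1.1⟫ ≤ i.2.1} = ∅ := by
    refine eq_empty_of_forall_notMem fun x hx => ?_
    obtain ⟨p, hp, hlt⟩ := hcon x
    have := mem_iInter.1 hx.2 (⟨p, hp⟩, ⟨⟪x + p.2, x - p.1⟫ / 2, half_pos hlt⟩)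
    simp only [mem_ofPred_eq] at this
    linarith
  obtain ⟨s, hs⟩ := (isCompact_inner_add_sub_le p₀.2 p₀.1 1).elim_finite_subfamily_closed _
    (fun i => (isCompact_inner_add_sub_le _ _ _).isClosed) hinter
  obtain ⟨ε, hε, hε1, hεs⟩ : ∃ ε : ℝ, 0 < ε ∧ ε ≤ 1 ∧ ∀ i ∈ s, ε ≤ i.2.1 := by
    have hne : (insert 1 (s.image fun i => i.2.1)).Nonempty := Finset.insert_nonempty _ _
    refine ⟨(insert 1 (s.image fun i => i.2.1)).min' hne, ?_, ?_, fun i hi => ?_⟩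
    · rw [Finset.lt_min'_iff]
      intro y hy
      rcases Finset.mem_insert.1 hy with rfl | hy
      · exact one_pos
      · obtain ⟨i, -, rfl⟩ := Finset.mem_image.1 hy
        exact i.2.2
    · exact Finset.min'_le _ _ (Finset.mem_insert_self _ _)
    · exact Finset.min'_le _ _ (Finset.mem_insert_of_mem (Finset.mem_image_of_mem _ hi))
  obtain ⟨x, hx⟩ := exists_inner_add_sub_lt (ι := Option s)
    (a := fun o => o.elim p₀.1 fun i => i.1.1.1.1) (v := fun o => o.elim p₀.2 fun i => i.1.1.1.2)
    (fun i j => by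
      rcases i with _ | i <;> rcases j with _ | j
      · exact hG _ hp₀ _ hp₀
      · exact hG _ hp₀ _ j.1.1.2
      · exact hG _ i.1.1.2 _ hp₀
      · exact hG _ i.1.1.2 _ j.1.1.2) hε
  refine (eq_empty_iff_forall_notMem.1 hs) x ⟨((hx none).trans_le hε1).le, ?_⟩
  exact mem_iInter₂.2 fun i hi => ((hx (some ⟨i, hi⟩)).trans_le (hεs i hi)).le

/-- **Minty's theorem** in finite dimension: `Id + γ A` is onto if `A` is maximal monotone. -/
theorem IsMaximalMonotone.exists_add_smul_eq {A : F → Set F} (hA : IsMaximalMonotone A) {γ : ℝ}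
    (hγ : 0 < γ) (y : F) : ∃ x, ∃ u ∈ scaled γ A x, x + u = y := by
  obtain ⟨x, hx⟩ := exists_forall_inner_add_sub_nonpos
    (G := {p : F × F | ∃ u ∈ A p.1, p.2 = γ • u - y}) (by
      rintro ⟨a, _⟩ ⟨u, hu, rfl⟩ ⟨b, _⟩ ⟨v, hv, rfl⟩
      have h := hA.1 a b u v hu hv
      simp only [zero_mul] at h
      simp only [sub_sub_sub_cancel_right, ← smul_sub, inner_smul_left, RCLike.conj_to_real]
      exact mul_nonneg hγ.le h)
  set w : F := γ⁻¹ • (y - x) with hw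
  have hγw : γ • w = y - x := by rw [hw, smul_smul, mul_inv_cancel₀ hγ.ne', one_smul]
  have hrel (a u : F) (hu : u ∈ A a) : 0 ≤ ⟪w - u, x - a⟫ := by
    have h : ⟪x + (γ • u - y), x - a⟫ ≤ 0 := hx (a, γ • u - y) ⟨u, hu, rfl⟩
    have h2 : x + (γ • u - y) = -(γ • (w - u)) := by rw [smul_sub, hγw]; abel
    rw [h2, inner_neg_left, inner_smul_left, RCLike.conj_to_real, neg_nonpos] at h
    exact nonneg_of_mul_nonneg_right h hγ
  have hmem : w ∈ A x := by
    refine hA.2 (fun z => A z ∪ {u | z = x ∧ u = w}) ?_ (fun z => subset_union_left) x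
      (Or.inr ⟨rfl, rfl⟩)
    rintro a b u v (hu | ⟨rfl, rfl⟩) (hv | ⟨rfl, rfl⟩)
    · exact hA.1 a b u v hu hv
    · have := hrel a u hu
      rw [← neg_sub w u, ← neg_sub b a, inner_neg_neg]
      simpa using this
    · simpa using hrel b v hv
    · simp
  exact ⟨x, γ • w, ⟨w, hmem, rfl⟩, by rw [hγw]; abel⟩

theorem IsMaximalMonotone.resolventFun_spec {A : F → Set F} (hA : IsMaximalMonotone A) {γ : ℝ}
    (hγ : 0 < γ) (y : F) :
    ∃ u ∈ scaled γ A (resolventFun (scaled γ A) y), resolventFun (scaled γ A) y + u = y :=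
  Classical.epsilon_spec (hA.exists_add_smul_eq hγ y)

omit [FiniteDimensional ℝ F] in
theorem MonotoneWith.norm_sub_le_of_add_eq {A : F → Set F} {α γ : ℝ} (hA : MonotoneWith α A)
    (hγ : 0 < γ) {x x' u u' : F} (hu : u ∈ scaled γ A x) (hu' : u' ∈ scaled γ A x') :
    (1 + γ * α) * ‖x - x'‖ ≤ ‖(x + u) - (x' + u')‖ := by
  obtain ⟨u, hu, rfl⟩ := hu
  obtain ⟨u', hu', rfl⟩ := hu'
  have h := mul_le_mul_of_nonneg_left (hA x x' u u' hu hu') hγ.le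
  have h2 := real_inner_le_norm ((x + γ • u) - (x' + γ • u')) (x - x')
  have h3 : (x + γ • u) - (x' + γ • u') = (x - x') + γ • (u - u') := by
    rw [smul_sub]
    abel
  rcases (norm_nonneg (x - x')).eq_or_lt with h0 | hpos
  · rw [← h0, mul_zero]
    exact norm_nonneg _
  · rw [h3, inner_add_left, inner_smul_left, RCLike.conj_to_real, real_inner_self_eq_norm_sq,
      ← h3] at h2
    refine le_of_mul_le_mul_right ?_ hpos
    nlinarith

theorem IsMaximalMonotone.resolventFun_eq_iff {A : F → Set F} (hA : IsMaximalMonotone A) {γ : ℝ}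
    (hγ : 0 < γ) {x y : F} :
    resolventFun (scaled γ A) y = x ↔ ∃ u ∈ scaled γ A x, x + u = y := by
  obtain ⟨u', hu', h'⟩ := hA.resolventFun_spec hγ y
  constructor
  · rintro rfl
    exact ⟨u', hu', h'⟩
  · rintro ⟨u, hu, h⟩
    have := hA.1.norm_sub_le_of_add_eq hγ hu' hu
    rw [h, h', sub_self, norm_zero, mul_zero, add_zero, one_mul] at this
    exact sub_eq_zero.1 (norm_le_zero_iff.1 this)

theorem IsMaximalMonotone.norm_resolventFun_sub_le {A : F → Set F} (hA : IsMaximalMonotone A)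
    {α γ : ℝ} (hα : MonotoneWith α A) (hγ : 0 < γ) (y y' : F) :
    (1 + γ * α) * ‖resolventFun (scaled γ A) y - resolventFun (scaled γ A) y'‖ ≤ ‖y - y'‖ := by
  obtain ⟨u, hu, h⟩ := hA.resolventFun_spec hγ y
  obtain ⟨u', hu', h'⟩ := hA.resolventFun_spec hγ y'
  simpa only [h, h'] using hα.norm_sub_le_of_add_eq hγ hu hu'

omit [FiniteDimensional ℝ F] in
theorem norm_forward_sub_le {B : F → F} {m β γ : ℝ} (hB : MonotoneWith m (singleValued B))
    (hLip : ∀ x y, ‖B x - B y‖ ≤ β * ‖x - y‖) (hγ : 0 < γ) (x y : F) :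
    ‖(x - γ • B x) - (y - γ • B y)‖ ≤ √(max 0 (1 - 2 * γ * m + γ ^ 2 * β ^ 2)) * ‖x - y‖ := by
  have h1 := hB x y (B x) (B y) rfl rfl
  have h2 : ‖B x - B y‖ ^ 2 ≤ (β * ‖x - y‖) ^ 2 :=
    pow_le_pow_left₀ (norm_nonneg _) (hLip x y) 2
  have h3 : (x - γ • B x) - (y - γ • B y) = (x - y) - γ • (B x - B y) := by
    rw [smul_sub]
    abel
  refine le_of_sq_le_sq ?_ (by positivity)
  rw [mul_pow, Real.sq_sqrt (le_max_left _ _), h3, norm_sub_sq_real, inner_smul_right,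
    norm_smul, mul_pow, Real.norm_eq_abs, sq_abs, real_inner_comm]
  have h4 := mul_le_mul_of_nonneg_right (le_max_right 0 (1 - 2 * γ * m + γ ^ 2 * β ^ 2))
    (sq_nonneg ‖x - y‖)
  nlinarith [mul_le_mul_of_nonneg_left h1 hγ.le, mul_le_mul_of_nonneg_left h2 (sq_nonneg γ)]

end Minty

section LocallyLipschitz

theorem locallyLipschitzOn_comp {α β δ : Type*} [PseudoEMetricSpace α] [PseudoEMetricSpace β]
    [PseudoEMetricSpace δ] {f : β → δ} {g : α → β} {s : Set α} {t : Set β}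
    (hf : LocallyLipschitzOn t f) (hg : LocallyLipschitzOn s g) (hst : MapsTo g s t) :
    LocallyLipschitzOn s (f ∘ g) := by
  intro x hx
  obtain ⟨Kg, u, hu, hgu⟩ := hg hx
  obtain ⟨Kf, w, hw, hfw⟩ := hf (hst hx)
  have hpre : g ⁻¹' w ∈ 𝓝[s] x := (hg.continuousOn x hx).tendsto_nhdsWithin hst hw
  exact ⟨Kf * Kg, u ∩ g ⁻¹' w, inter_mem hu hpre,
    (hfw.mono (image_subset_iff.2 inter_subset_right)).comp (hgu.mono inter_subset_left)
      (mapsTo_image _ _)⟩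

theorem locallyLipschitzOn_prodMk {α β δ : Type*} [PseudoEMetricSpace α] [PseudoEMetricSpace β]
    [PseudoEMetricSpace δ] {f : α → β} {g : α → δ} {s : Set α}
    (hf : LocallyLipschitzOn s f) (hg : LocallyLipschitzOn s g) :
    LocallyLipschitzOn s fun x => (f x, g x) := by
  intro x hx
  obtain ⟨Kf, u, hu, hfu⟩ := hf hx
  obtain ⟨Kg, w, hw, hgw⟩ := hg hx
  exact ⟨max Kf Kg, u ∩ w, inter_mem hu hw,
    (hfu.mono inter_subset_left).prodMk (hgw.mono inter_subset_right)⟩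

theorem _root_.AbsolutelyContinuousOnInterval.comp_locallyLipschitzOn {X Y : Type*}
    [SeminormedAddCommGroup X] [PseudoMetricSpace Y] {c : ℝ → X} {a b : ℝ}
    (hc : AbsolutelyContinuousOnInterval c a b) {U : Set X} {f : X → Y}
    (hf : LocallyLipschitzOn U f) (hcU : MapsTo c (uIcc a b) U) :
    AbsolutelyContinuousOnInterval (fun t => f (c t)) a b := by
  have hcomp : IsCompact (c '' uIcc a b) := isCompact_uIcc.image_of_continuousOn hc.continuousOn
  have hlip : LocallyLipschitzOn (c '' uIcc a b) f := hf.mono hcU.image_subset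
  obtain ⟨K, hK⟩ := hlip.exists_lipschitzOnWith_of_compact hcomp
  rw [absolutelyContinuousOnInterval_iff] at hc ⊢
  intro ε hε
  obtain ⟨δ, hδ, h⟩ := hc (ε / (K + 1)) (by positivity)
  refine ⟨δ, hδ, fun I hI hlt => ?_⟩
  calc ∑ i ∈ Finset.range I.1, dist (f (c (I.2 i).1)) (f (c (I.2 i).2))
      ≤ ∑ i ∈ Finset.range I.1, (K + 1) * dist (c (I.2 i).1) (c (I.2 i).2) := by
        refine Finset.sum_le_sum fun i hi => ?_
        refine (hK.dist_le_mul _ (mem_image_of_mem _ (hI.1 i hi).1) _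
          (mem_image_of_mem _ (hI.1 i hi).2)).trans ?_
        gcongr
        simp
    _ = (K + 1) * ∑ i ∈ Finset.range I.1, dist (c (I.2 i).1) (c (I.2 i).2) := by
        rw [Finset.mul_sum]
    _ < (K + 1) * (ε / (K + 1)) := by
        gcongr
        exact h I hI hlt
    _ = ε := by field_simp

theorem _root_.AbsolutelyContinuousOnInterval.ae_differentiableAt_Ioo {V : Type*}
    [NormedAddCommGroup V] [NormedSpace ℝ V] [FiniteDimensional ℝ V] {c : ℝ → V}
    (hc : AbsolutelyContinuousOnInterval c 0 1) :
    ∀ᵐ t ∂(volume.restrict (Icc (0 : ℝ) 1)), t ∈ Ioo (0 : ℝ) 1 ∧ DifferentiableAt ℝ c t := by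
  have hbv := hc.boundedVariationOn.locallyBoundedVariationOn
  rw [uIcc_of_le zero_le_one] at hbv
  have hIoo : ∀ᵐ t ∂(volume.restrict (Icc (0 : ℝ) 1)), t ∈ Ioo (0 : ℝ) 1 := by
    rw [Measure.restrict_congr_set Ioo_ae_eq_Icc.symm]
    exact ae_restrict_mem measurableSet_Ioo
  filter_upwards [hbv.ae_differentiableWithinAt measurableSet_Icc, hIoo] with t ht htI
  exact ⟨htI, ht.differentiableAt (Icc_mem_nhds htI.1 htI.2)⟩

end LocallyLipschitz

section Blocks

variable {E F : Type*} [NormedAddCommGroup E] [NormedSpace ℝ E]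
  [NormedAddCommGroup F] [InnerProductSpace ℝ F]

theorem norm_smul_sub_blockx_le {f : E × F → F} {Θ : Set E} (hΘ : IsOpen Θ) {a b κ : ℝ}
    (hf : ∀ θ ∈ Θ, ∀ x x', ‖a • (x - x') - b • (f (θ, x) - f (θ, x'))‖ ≤ κ * ‖x - x'‖)
    {θ : E} (hθ : θ ∈ Θ) {x : F} {D : E × F →L[ℝ] F} (hD : D ∈ clarkeJacobian f (θ, x)) (v : F) :
    ‖a • v - b • blockx D v‖ ≤ κ * ‖v‖ := by
  rw [clarkeJacobian_eq] at hD
  set S : Set (E × F →L[ℝ] F) := {D | ‖a • v - b • blockx D v‖ ≤ κ * ‖v‖} with hS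
  have hSc : IsClosed S := by
    refine isClosed_le ?_ continuous_const
    simp only [blockx, ContinuousLinearMap.comp_apply]
    fun_prop
  have hconv : Convex ℝ S := by
    intro D₁ h₁ D₂ h₂ s t hs ht hst
    have heq : a • v - b • blockx (s • D₁ + t • D₂) v =
        s • (a • v - b • blockx D₁ v) + t • (a • v - b • blockx D₂ v) := by
      simp only [blockx, ContinuousLinearMap.comp_apply, add_apply, smul_apply]
      obtain rfl : t = 1 - s := by linarith
      module
    simp only [hS, mem_ofPred_eq] at h₁ h₂ ⊢
    rw [heq]
    refine (norm_add_le _ _).trans ?_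
    rw [norm_smul, norm_smul, Real.norm_of_nonneg hs, Real.norm_of_nonneg ht]
    calc s * ‖a • v - b • blockx D₁ v‖ + t * ‖a • v - b • blockx D₂ v‖
        ≤ s * (κ * ‖v‖) + t * (κ * ‖v‖) := by gcongr
      _ = κ * ‖v‖ := by rw [← add_mul, hst, one_mul]
  refine convexHull_min (fun L hL => ?_) hconv hD
  rw [mem_ofPred_eq, mem_closure_iff_frequently] at hL
  rw [← hSc.closure_eq, mem_closure_iff_frequently]
  have hev : ∀ᶠ q : (E × F) × (E × F →L[ℝ] F) in 𝓝 ((θ, x), L), q.1.1 ∈ Θ :=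
    (continuous_fst.comp continuous_fst).continuousAt.eventually (hΘ.mem_nhds hθ)
  have hfr := hL.and_eventually hev
  refine (continuous_snd.tendsto ((θ, x), L)).frequently (hfr.mono ?_)
  rintro ⟨⟨θ', y⟩, M⟩ ⟨⟨hd, hM⟩, hθ'⟩
  simp only at hd hM hθ'
  have hlim := (hd.hasFDerivAt.hasLineDerivAt (0, v)).tendsto_slope_zero
  refine le_of_tendsto (((hlim.const_smul b).const_sub (a • v)).norm) ?_ |>.trans_eq' ?_
  · filter_upwards [self_mem_nhdsWithin] with t ht
    have ht0 : t ≠ 0 := ht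
    have h := hf θ' hθ' (y + t • v) y
    rw [add_sub_cancel_left] at h
    have heq : a • t • v - b • (f (θ', y + t • v) - f (θ', y)) =
        t • (a • v - b • t⁻¹ • (f ((θ', y) + t • (0, v)) - f (θ', y))) := by
      have : (θ', y) + t • ((0 : E), v) = (θ', y + t • v) := by simp
      rw [this, smul_sub t, smul_comm t b, smul_smul t t⁻¹, mul_inv_cancel₀ ht0, one_smul,
        smul_comm t a]
    rw [heq, norm_smul, norm_smul] at h
    refine le_of_mul_le_mul_left ?_ (norm_pos_iff.2 ht0)
    linarith
  · simp [hM, blockx]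

theorem norm_partialx_apply_le {T B : E × F → F} {Θ : Set E} (hΘ : IsOpen Θ) {γ κ₁ κ₂ : ℝ}
    (hκ₁ : 0 ≤ κ₁) (hT : ∀ θ ∈ Θ, ∀ y y', ‖T (θ, y) - T (θ, y')‖ ≤ κ₁ * ‖y - y'‖)
    (hB : ∀ θ ∈ Θ, ∀ x x', ‖(x - γ • B (θ, x)) - (x' - γ • B (θ, x'))‖ ≤ κ₂ * ‖x - x'‖)
    {θ : E} (hθ : θ ∈ Θ) {x y : F} {D K : E × F →L[ℝ] F} (hD : D ∈ clarkeJacobian T (θ, y))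
    (hK : K ∈ clarkeJacobian B (θ, x)) (v : F) :
    ‖partialx γ D K v‖ ≤ κ₁ * κ₂ * ‖v‖ := by
  have h1 (w : F) : ‖blockx D w‖ ≤ κ₁ * ‖w‖ := by
    have := norm_smul_sub_blockx_le hΘ (a := 0) (b := 1) (κ := κ₁)
      (fun θ hθ y y' => by simpa [norm_sub_rev] using hT θ hθ y y') hθ hD w
    simpa using this
  have h2 : ‖v - γ • blockx K v‖ ≤ κ₂ * ‖v‖ := by
    have := norm_smul_sub_blockx_le hΘ (a := 1) (b := γ) (κ := κ₂)
      (fun θ hθ x x' => by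
        have := hB θ hθ x x'
        rwa [one_smul, smul_sub, sub_sub_sub_comm]) hθ hK v
    simpa using this
  calc ‖partialx γ D K v‖ = ‖blockx D (v - γ • blockx K v)‖ := rfl
    _ ≤ κ₁ * ‖v - γ • blockx K v‖ := h1 _
    _ ≤ κ₁ * (κ₂ * ‖v‖) := by gcongr
    _ = κ₁ * κ₂ * ‖v‖ := by ring

theorem isInvertible_id_sub [FiniteDimensional ℝ F] {P : F →L[ℝ] F} {κ : ℝ} (hκ : κ < 1)
    (hP : ∀ v, ‖P v‖ ≤ κ * ‖v‖) : (ContinuousLinearMap.id ℝ F - P).IsInvertible := by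
  have hinj : Function.Injective (ContinuousLinearMap.id ℝ F - P : F →L[ℝ] F).toLinearMap := by
    rw [← LinearMap.ker_eq_bot, LinearMap.ker_eq_bot']
    intro v hv
    have hv' : P v = v := (sub_eq_zero.1 hv).symm
    have := hP v
    rw [hv'] at this
    exact norm_le_zero_iff.1 (by nlinarith [norm_nonneg v])
  exact ⟨(LinearEquiv.ofInjectiveEndo _ hinj).toContinuousLinearEquiv, by ext v; rfl⟩

end Blocks

section Contraction

variable {E F : Type*} [NormedAddCommGroup E] [NormedSpace ℝ E]
  [NormedAddCommGroup F] [InnerProductSpace ℝ F]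
  {Θ : Set E} {A : E → F → Set F} {B : E → F → F} {γ κ₁ κ₂ : ℝ}

/-- The forward step `(θ, x) ↦ (θ, x - γ B_θ(x))`. -/
def forwardMap (γ : ℝ) (B : E → F → F) : E × F → E × F := fun z => (z.1, z.2 - γ • B z.1 z.2)

theorem StandingAssumption.locallyLipschitzOn_forwardMap (h : StandingAssumption Θ A B γ) :
    LocallyLipschitzOn (Θ ×ˢ univ) (forwardMap γ B) := by
  let Φ : (E × F) × F →L[ℝ] E × F :=
    ((ContinuousLinearMap.fst ℝ E F).comp (ContinuousLinearMap.fst ℝ (E × F) F)).prod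
      ((ContinuousLinearMap.snd ℝ E F).comp (ContinuousLinearMap.fst ℝ (E × F) F) -
        γ • ContinuousLinearMap.snd ℝ (E × F) F)
  exact locallyLipschitzOn_comp (Φ.lipschitz.locallyLipschitz.locallyLipschitzOn (s := univ))
    (locallyLipschitzOn_prodMk LocallyLipschitz.id.locallyLipschitzOn
      h.pathDifferentiable_B.1) (mapsTo_univ _ _)

theorem StandingAssumption.locallyLipschitzOn_forwardBackward (h : StandingAssumption Θ A B γ) :
    LocallyLipschitzOn (Θ ×ˢ univ) (resolventMap γ A ∘ forwardMap γ B) :=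
  locallyLipschitzOn_comp h.pathDifferentiable_T.1 h.locallyLipschitzOn_forwardMap
    fun _ hz => ⟨hz.1, mem_univ _⟩

theorem StandingAssumption.mem_solutionSet_iff [FiniteDimensional ℝ F]
    (h : StandingAssumption Θ A B γ) {θ : E} (hθ : θ ∈ Θ) {x : F} :
    x ∈ solutionSet A B θ ↔ resolventMap γ A (forwardMap γ B (θ, x)) = x := by
  refine Iff.trans ?_ ((h.maximalMonotone_A θ hθ).resolventFun_eq_iff h.gamma_pos).symm
  constructor
  · rintro ⟨u, hu, hsum⟩
    refine ⟨γ • u, ⟨u, hu, rfl⟩, ?_⟩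
    simp only [forwardMap, eq_neg_of_add_eq_zero_left hsum, smul_neg, sub_eq_add_neg]
  · rintro ⟨_, ⟨u, hu, rfl⟩, hsum⟩
    refine ⟨u, hu, ?_⟩
    have h0 : γ • (u + B θ x) = 0 := by
      simp only [forwardMap, sub_eq_add_neg, add_right_inj] at hsum
      rw [smul_add, hsum, neg_add_cancel]
    exact (smul_eq_zero.1 h0).resolve_left h.gamma_pos.ne'

theorem exists_contraction_constants [FiniteDimensional ℝ F] {α β : ℝ} (hα : 0 < α) (hβ : 0 < β)
    (h : StandingAssumption Θ A B γ)
    (hLip : ∀ θ ∈ Θ, ∀ x y, ‖B θ x - B θ y‖ ≤ β * ‖x - y‖)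
    (hstrong : (∀ θ ∈ Θ, MonotoneWith α (A θ)) ∨
      (∀ θ ∈ Θ, MonotoneWith α (singleValued (B θ))))
    (hγ : γ < 2 * α / (α + β) ^ 2) :
    ∃ κ₁ κ₂ : ℝ, 0 ≤ κ₁ ∧ 0 ≤ κ₂ ∧ κ₁ * κ₂ < 1 ∧
      (∀ θ ∈ Θ, ∀ y y',
        ‖resolventMap γ A (θ, y) - resolventMap γ A (θ, y')‖ ≤ κ₁ * ‖y - y'‖) ∧
      (∀ θ ∈ Θ, ∀ x x', ‖(x - γ • B θ x) - (x' - γ • B θ x')‖ ≤ κ₂ * ‖x - x'‖) := by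
  have hγ0 := h.gamma_pos
  have hγ' : γ * (α + β) ^ 2 < 2 * α := (lt_div_iff₀ (by positivity)).1 hγ
  rcases hstrong with hs | hs
  · refine ⟨(1 + γ * α)⁻¹, √(max 0 (1 - 2 * γ * 0 + γ ^ 2 * β ^ 2)), by positivity,
      Real.sqrt_nonneg _, ?_, fun θ hθ y y' => ?_, fun θ hθ => ?_⟩
    · rw [inv_mul_lt_iff₀ (by positivity), mul_one, Real.sqrt_lt' (by positivity), max_lt_iff]
      refine ⟨by positivity, ?_⟩
      have : γ * β ^ 2 < 2 * α + γ * α ^ 2 := by nlinarith [mul_pos hα hβ, mul_pos hγ0 hα]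
      nlinarith
    · rw [le_inv_mul_iff₀ (by positivity)]
      exact (h.maximalMonotone_A θ hθ).norm_resolventFun_sub_le (hs θ hθ) hγ0 y y'
    · exact norm_forward_sub_le (h.maximalMonotone_B θ hθ).1 (hLip θ hθ) hγ0
  · refine ⟨1, √(max 0 (1 - 2 * γ * α + γ ^ 2 * β ^ 2)), zero_le_one,
      Real.sqrt_nonneg _, ?_, fun θ hθ y y' => ?_, fun θ hθ => ?_⟩
    · rw [one_mul, Real.sqrt_lt' one_pos, max_lt_iff]
      refine ⟨by norm_num, ?_⟩
      have : γ * β ^ 2 < 2 * α := by nlinarith [mul_pos hα hβ, sq_nonneg α]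
      nlinarith
    · simpa [resolventMap] using (h.maximalMonotone_A θ hθ).norm_resolventFun_sub_le
        (h.maximalMonotone_A θ hθ).1 hγ0 y y'
    · exact norm_forward_sub_le (hs θ hθ) (hLip θ hθ) hγ0

end Contraction

section Solution

variable {E F : Type*} [NormedAddCommGroup E] [NormedSpace ℝ E]
  [NormedAddCommGroup F] [InnerProductSpace ℝ F] [FiniteDimensional ℝ F]
  {Θ : Set E} {A : E → F → Set F} {B : E → F → F} {γ κ₁ κ₂ : ℝ} {xs : E → F}

omit [NormedAddCommGroup E] [NormedSpace ℝ E] [FiniteDimensional ℝ F] in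
theorem norm_forwardBackward_sub_le (hκ₁ : 0 ≤ κ₁)
    (hT : ∀ θ ∈ Θ, ∀ y y',
      ‖resolventMap γ A (θ, y) - resolventMap γ A (θ, y')‖ ≤ κ₁ * ‖y - y'‖)
    (hB : ∀ θ ∈ Θ, ∀ x x', ‖(x - γ • B θ x) - (x' - γ • B θ x')‖ ≤ κ₂ * ‖x - x'‖)
    {θ : E} (hθ : θ ∈ Θ) (x x' : F) :
    ‖resolventMap γ A (forwardMap γ B (θ, x)) - resolventMap γ A (forwardMap γ B (θ, x'))‖ ≤
      κ₁ * κ₂ * ‖x - x'‖ := by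
  rw [mul_assoc]
  exact (hT θ hθ _ _).trans (mul_le_mul_of_nonneg_left (hB θ hθ x x') hκ₁)

theorem StandingAssumption.solution_unique (h : StandingAssumption Θ A B γ) (hκ₁ : 0 ≤ κ₁)
    (hκ : κ₁ * κ₂ < 1)
    (hT : ∀ θ ∈ Θ, ∀ y y',
      ‖resolventMap γ A (θ, y) - resolventMap γ A (θ, y')‖ ≤ κ₁ * ‖y - y'‖)
    (hB : ∀ θ ∈ Θ, ∀ x x', ‖(x - γ • B θ x) - (x' - γ • B θ x')‖ ≤ κ₂ * ‖x - x'‖)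
    {θ : E} (hθ : θ ∈ Θ) {x x' : F} (hx : x ∈ solutionSet A B θ) (hx' : x' ∈ solutionSet A B θ) :
    x = x' := by
  have hle := norm_forwardBackward_sub_le hκ₁ hT hB hθ x x'
  rw [(h.mem_solutionSet_iff hθ).1 hx, (h.mem_solutionSet_iff hθ).1 hx'] at hle
  exact sub_eq_zero.1 (norm_le_zero_iff.1 (by nlinarith [norm_nonneg (x - x')]))

theorem StandingAssumption.locallyLipschitzOn_solution (h : StandingAssumption Θ A B γ)
    (hκ₁ : 0 ≤ κ₁) (hκ : κ₁ * κ₂ < 1)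
    (hT : ∀ θ ∈ Θ, ∀ y y',
      ‖resolventMap γ A (θ, y) - resolventMap γ A (θ, y')‖ ≤ κ₁ * ‖y - y'‖)
    (hB : ∀ θ ∈ Θ, ∀ x x', ‖(x - γ • B θ x) - (x' - γ • B θ x')‖ ≤ κ₂ * ‖x - x'‖)
    (hxs : ∀ θ ∈ Θ, xs θ ∈ solutionSet A B θ) : LocallyLipschitzOn Θ xs := by
  intro θ₀ hθ₀
  obtain ⟨K, r, hr, -, hK⟩ := exists_lipschitzOnWith_closedBall (h.isOpen.prod isOpen_univ)
    h.locallyLipschitzOn_forwardBackward (x := (θ₀, xs θ₀)) ⟨hθ₀, mem_univ _⟩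
  have hκ' : 0 < 1 - κ₁ * κ₂ := by linarith
  set C : ℝ := K / (1 - κ₁ * κ₂) with hC
  have hC0 : 0 ≤ C := div_nonneg K.2 hκ'.le
  have key {θ θ' : E} (hθ : θ ∈ Θ) (hθ' : θ' ∈ Θ)
      (h1 : (θ, xs θ') ∈ Metric.closedBall (θ₀, xs θ₀) r)
      (h2 : (θ', xs θ') ∈ Metric.closedBall (θ₀, xs θ₀) r) :
      ‖xs θ - xs θ'‖ ≤ C * ‖θ - θ'‖ := by
    have hle := norm_forwardBackward_sub_le hκ₁ hT hB hθ (xs θ) (xs θ')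
    have hd := hK.norm_sub_le h1 h2
    simp only [Function.comp_apply, (h.mem_solutionSet_iff hθ').1 (hxs θ' hθ'),
      Prod.mk_sub_mk, sub_self, Prod.norm_mk, norm_zero, norm_nonneg, sup_of_le_left] at hd
    rw [(h.mem_solutionSet_iff hθ).1 (hxs θ hθ)] at hle
    have htri := norm_sub_le_norm_sub_add_norm_sub (xs θ)
      (resolventMap γ A (forwardMap γ B (θ, xs θ'))) (xs θ')
    rw [hC, div_mul_eq_mul_div, le_div_iff₀ hκ']
    linarith
  have hev : ∀ᶠ θ in 𝓝[Θ] θ₀, θ ∈ Θ ∧ θ ∈ Metric.closedBall θ₀ r ∧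
      xs θ ∈ Metric.closedBall (xs θ₀) r := by
    have hr' : 0 < r / (C + 1) := by positivity
    filter_upwards [self_mem_nhdsWithin,
      mem_nhdsWithin_of_mem_nhds (Metric.closedBall_mem_nhds θ₀ hr),
      mem_nhdsWithin_of_mem_nhds (Metric.closedBall_mem_nhds θ₀ hr')] with θ hθ hθr hθr'
    refine ⟨hθ, hθr, ?_⟩
    have hle := key hθ hθ₀ (by simpa [Prod.dist_eq, hr.le] using hθr)
      (Metric.mem_closedBall_self hr.le)
    rw [Metric.mem_closedBall, dist_eq_norm] at hθr' ⊢
    rw [le_div_iff₀ (by positivity)] at hθr'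
    nlinarith [norm_nonneg (θ - θ₀)]
  refine ⟨C.toNNReal, _, hev, LipschitzOnWith.of_dist_le_mul ?_⟩
  rintro θ ⟨hθ, hθr, -⟩ θ' ⟨hθ', hθr', hxr'⟩
  rw [dist_eq_norm, dist_eq_norm, Real.coe_toNNReal _ hC0]
  refine key hθ hθ' ?_ ?_ <;> rw [Metric.mem_closedBall, Prod.dist_eq]
  · exact max_le hθr hxr'
  · exact max_le hθr' hxr'

variable [FiniteDimensional ℝ E]

omit [FiniteDimensional ℝ F] [FiniteDimensional ℝ E] in
theorem mem_solutionJacobian_iff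
    (hinv : ∀ θ ∈ Θ, ∀ D ∈ jacT γ A B θ (xs θ), ∀ K ∈ jacB B θ (xs θ),
      (ContinuousLinearMap.id ℝ F - partialx γ D K).IsInvertible) {θ : E} (hθ : θ ∈ Θ)
    {M : E →L[ℝ] F} :
    M ∈ solutionJacobian γ A B xs θ ↔ ∃ D ∈ jacT γ A B θ (xs θ), ∃ K ∈ jacB B θ (xs θ),
      (ContinuousLinearMap.id ℝ F - partialx γ D K).comp M = partialθ γ D K := by
  unfold solutionJacobian
  refine exists_congr fun D => and_congr_right fun hD => exists_congr fun K =>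
    and_congr_right fun hK => ?_
  have hi := hinv θ hθ D hD K hK
  constructor
  · rintro rfl
    ext v
    exact hi.self_apply_inverse _
  · intro hM
    ext v
    rw [← hM]
    exact (hi.inverse_apply_self _).symm

omit [FiniteDimensional ℝ F] [FiniteDimensional ℝ E] in
theorem continuous_partialx (γ : ℝ) :
    Continuous fun q : (E × F →L[ℝ] F) × (E × F →L[ℝ] F) => partialx γ q.1 q.2 := by
  unfold partialx blockx
  fun_prop

omit [FiniteDimensional ℝ F] [FiniteDimensional ℝ E] in
theorem continuous_partialθ (γ : ℝ) :
    Continuous fun q : (E × F →L[ℝ] F) × (E × F →L[ℝ] F) => partialθ γ q.1 q.2 := by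
  unfold partialθ blockx blockθ
  fun_prop

omit [FiniteDimensional ℝ F] [FiniteDimensional ℝ E] in
theorem isClosed_setOf_linearSystem (γ : ℝ) :
    IsClosed {q : ((E × F →L[ℝ] F) × (E × F →L[ℝ] F)) × (E →L[ℝ] F) |
      (ContinuousLinearMap.id ℝ F - partialx γ q.1.1 q.1.2).comp q.2 =
        partialθ γ q.1.1 q.1.2} := by
  have hP : Continuous fun q : ((E × F →L[ℝ] F) × (E × F →L[ℝ] F)) × (E →L[ℝ] F) =>
      ContinuousLinearMap.id ℝ F - partialx γ q.1.1 q.1.2 :=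
    continuous_const.sub ((continuous_partialx γ).comp continuous_fst)
  exact isClosed_eq (hP.clm_comp continuous_snd) ((continuous_partialθ γ).comp continuous_fst)

omit [FiniteDimensional ℝ F] [FiniteDimensional ℝ E] in
theorem partialx_add_partialθ_apply (γ : ℝ) (D K : E × F →L[ℝ] F) (v : E) (w : F) :
    partialx γ D K w + partialθ γ D K v = D (v, w - γ • K (v, w)) := by
  have hK : K (v, w) = K (v, 0) + K (0, w) := by rw [← map_add]; simp
  have hD : D (v, w - γ • K (v, w)) = D (v, 0) + D (0, w - γ • K (v, w)) := by
    rw [← map_add]; simp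
  have hD' : D (0, w - γ • K (v, w)) = D (0, w - γ • K (0, w)) - γ • D (0, K (v, 0)) := by
    have heq : ((0 : E), w - γ • K (v, w)) = (0, w - γ • K (0, w)) - γ • (0, K (v, 0)) := by
      rw [hK, smul_add, Prod.smul_mk, smul_zero, Prod.mk_sub_mk, sub_zero]
      congr 1
      abel
    rw [heq, map_sub, map_smul]
  rw [hD, hD']
  simp only [partialx, partialθ, blockx, blockθ, ContinuousLinearMap.comp_apply, sub_apply,
    smul_apply, ContinuousLinearMap.inl_apply, ContinuousLinearMap.inr_apply,
    ContinuousLinearMap.id_apply]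
  abel

/-- Along a curve of parameters, the derivative of the solution solves the linear system given by
any choice of Clarke Jacobians. -/
theorem StandingAssumption.ae_deriv_solution_eq (h : StandingAssumption Θ A B γ)
    (hlip : LocallyLipschitzOn Θ xs) (hxs : ∀ θ ∈ Θ, xs θ ∈ solutionSet A B θ) {c : ℝ → E}
    (hc : AbsolutelyContinuousOnInterval c 0 1) (hcΘ : MapsTo c (Icc 0 1) Θ) :
    ∀ᵐ t ∂(volume.restrict (Icc (0 : ℝ) 1)),
      ∃ y' : F, HasDerivAt (fun s => xs (c s)) y' t ∧
        ∀ D ∈ jacT γ A B (c t) (xs (c t)), ∀ K ∈ jacB B (c t) (xs (c t)),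
          partialx γ D K y' + partialθ γ D K (deriv c t) = y' := by
  have hI : uIcc (0 : ℝ) 1 = Icc 0 1 := uIcc_of_le zero_le_one
  have hopen : IsOpen (Θ ×ˢ (univ : Set F)) := h.isOpen.prod isOpen_univ
  have hy := hc.comp_locallyLipschitzOn hlip (hI ▸ hcΘ)
  have hz : AbsolutelyContinuousOnInterval (fun t => (c t, xs (c t))) 0 1 :=
    hc.comp_locallyLipschitzOn (locallyLipschitzOn_prodMk LocallyLipschitz.id.locallyLipschitzOn hlip)
      (hI ▸ hcΘ)
  have hzU : MapsTo (fun t => (c t, xs (c t))) (Icc 0 1) (Θ ×ˢ (univ : Set F)) :=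
    fun t ht => ⟨hcΘ ht, mem_univ _⟩
  have hw := hz.comp_locallyLipschitzOn h.locallyLipschitzOn_forwardMap (hI ▸ hzU)
  have hwU : MapsTo (fun t => forwardMap γ B (c t, xs (c t))) (Icc 0 1) (Θ ×ˢ (univ : Set F)) :=
    fun t ht => ⟨hcΘ ht, mem_univ _⟩
  have hJB := h.pathDifferentiable_B.isConservativeJacobianOn_clarkeJacobian hopen
  have hJT := h.pathDifferentiable_T.isConservativeJacobianOn_clarkeJacobian hopen
  filter_upwards [hc.ae_differentiableAt_Ioo, hy.ae_differentiableAt_Ioo,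
    hJB.chainRule _ hz hzU, hJT.chainRule _ hw hwU] with t ⟨htI, hct⟩ ⟨_, hyt⟩ hBt hTt
  refine ⟨_, hyt.hasDerivAt, fun D hD K hK => ?_⟩
  set y' := deriv (fun s => xs (c s)) t
  have hzd : HasDerivAt (fun s => (c s, xs (c s))) (deriv c t, y') t :=
    hct.hasDerivAt.prodMk hyt.hasDerivAt
  have hBd := hBt K hK
  rw [HasDerivAt.deriv hzd] at hBd
  have hwd : HasDerivAt (fun s => forwardMap γ B (c s, xs (c s)))
      (deriv c t, y' - γ • K (deriv c t, y')) t :=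
    hct.hasDerivAt.prodMk (hyt.hasDerivAt.sub (hBd.const_smul γ))
  have hTd := hTt D hD
  rw [HasDerivAt.deriv hwd] at hTd
  have heq : (fun s => xs (c s)) =ᶠ[𝓝 t]
      fun s => resolventMap γ A (forwardMap γ B (c s, xs (c s))) := by
    filter_upwards [Icc_mem_nhds htI.1 htI.2] with s hs
    exact ((h.mem_solutionSet_iff (hcΘ hs)).1 (hxs _ (hcΘ hs))).symm
  rw [partialx_add_partialθ_apply]
  exact (hTd.congr_of_eventuallyEq heq).unique hyt.hasDerivAt

omit [FiniteDimensional ℝ F] [FiniteDimensional ℝ E] in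
theorem StandingAssumption.continuousOn_forwardMap_solution (h : StandingAssumption Θ A B γ)
    (hc : ContinuousOn xs Θ) : ContinuousOn (fun θ => forwardMap γ B (θ, xs θ)) Θ :=
  h.locallyLipschitzOn_forwardMap.continuousOn.comp (continuousOn_id.prodMk hc)
    fun _ hθ => ⟨hθ, mem_univ _⟩

theorem StandingAssumption.eventually_jac_mem_closedBall (h : StandingAssumption Θ A B γ)
    (hc : ContinuousOn xs Θ) {θ : E} (hθ : θ ∈ Θ) :
    ∃ C : ℝ, ∀ᶠ θ' in 𝓝[Θ] θ, ∀ D ∈ jacT γ A B θ' (xs θ'), ∀ K ∈ jacB B θ' (xs θ'),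
      (D, K) ∈ Metric.closedBall (0 : E × F →L[ℝ] F) C ×ˢ
        Metric.closedBall (0 : E × F →L[ℝ] F) C := by
  have hopen : IsOpen (Θ ×ˢ (univ : Set F)) := h.isOpen.prod isOpen_univ
  obtain ⟨C₁, h₁⟩ := (hasLocallyCompactGraphOn_clarkeJacobian hopen
    h.pathDifferentiable_T.1).exists_bound (x := forwardMap γ B (θ, xs θ)) ⟨hθ, mem_univ _⟩
  obtain ⟨C₂, h₂⟩ := (hasLocallyCompactGraphOn_clarkeJacobian hopen
    h.pathDifferentiable_B.1).exists_bound (x := (θ, xs θ)) ⟨hθ, mem_univ _⟩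
  refine ⟨max C₁ C₂, ?_⟩
  filter_upwards [(h.continuousOn_forwardMap_solution hc θ hθ).eventually h₁,
    ((continuousOn_id.prodMk hc) θ hθ).eventually h₂] with θ' h₁ h₂ D hD K hK
  exact mk_mem_prod (mem_closedBall_zero_iff.2 ((h₁ D hD).trans (le_max_left _ _)))
    (mem_closedBall_zero_iff.2 ((h₂ K hK).trans (le_max_right _ _)))

theorem StandingAssumption.solutionJacobian_locallyBounded (h : StandingAssumption Θ A B γ)
    (hc : ContinuousOn xs Θ) {κ : ℝ} (hκ : κ < 1)
    (hinv : ∀ θ ∈ Θ, ∀ D ∈ jacT γ A B θ (xs θ), ∀ K ∈ jacB B θ (xs θ),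
      (ContinuousLinearMap.id ℝ F - partialx γ D K).IsInvertible)
    (hP : ∀ θ ∈ Θ, ∀ D ∈ jacT γ A B θ (xs θ), ∀ K ∈ jacB B θ (xs θ),
      ∀ v, ‖partialx γ D K v‖ ≤ κ * ‖v‖) {θ : E} (hθ : θ ∈ Θ) :
    ∃ C : ℝ, ∀ᶠ θ' in 𝓝[Θ] θ, ∀ M ∈ solutionJacobian γ A B xs θ', ‖M‖ ≤ C := by
  have hproper : ProperSpace (E × F →L[ℝ] F) := FiniteDimensional.proper ℝ (E × F →L[ℝ] F)
  obtain ⟨C, hC⟩ := h.eventually_jac_mem_closedBall hc hθ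
  obtain ⟨R, hR⟩ : ∃ R, ∀ q ∈ Metric.closedBall (0 : E × F →L[ℝ] F) C ×ˢ
      Metric.closedBall (0 : E × F →L[ℝ] F) C, ‖partialθ γ q.1 q.2‖ ≤ R :=
    ((isCompact_closedBall (0 : E × F →L[ℝ] F) C).prod
      (isCompact_closedBall (0 : E × F →L[ℝ] F) C)).exists_bound_of_continuousOn
        (continuous_partialθ γ).continuousOn
  refine ⟨R / (1 - κ), ?_⟩
  filter_upwards [hC, self_mem_nhdsWithin] with θ' hDK hθ' M hM
  obtain ⟨D, hD, K, hK, hM⟩ := (mem_solutionJacobian_iff hinv hθ').1 hM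
  have hQ : ‖partialθ γ D K‖ ≤ R := hR (D, K) (hDK D hD K hK)
  have hR0 : 0 ≤ R := (norm_nonneg _).trans hQ
  have hκ' : 0 < 1 - κ := by linarith
  refine ContinuousLinearMap.opNorm_le_bound _ (div_nonneg hR0 hκ'.le) fun v => ?_
  have hMv : M v - partialx γ D K (M v) = partialθ γ D K v := congrArg (fun L => L v) hM
  have h1 := hP θ' hθ' D hD K hK (M v)
  have h2 := (partialθ γ D K).le_of_opNorm_le hQ v
  have h3 := norm_sub_norm_le (M v) (partialx γ D K (M v))
  rw [hMv] at h3
  rw [div_mul_eq_mul_div, le_div_iff₀ hκ']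
  linarith

theorem StandingAssumption.solutionJacobian_graphClosed (h : StandingAssumption Θ A B γ)
    (hc : ContinuousOn xs Θ)
    (hinv : ∀ θ ∈ Θ, ∀ D ∈ jacT γ A B θ (xs θ), ∀ K ∈ jacB B θ (xs θ),
      (ContinuousLinearMap.id ℝ F - partialx γ D K).IsInvertible) {θ : E} (hθ : θ ∈ Θ)
    {L : E →L[ℝ] F} (hL : (θ, L) ∈ closure {q : E × (E →L[ℝ] F) |
      q.1 ∈ Θ ∧ q.2 ∈ solutionJacobian γ A B xs q.1}) :
    L ∈ solutionJacobian γ A B xs θ := by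
  have hopen : IsOpen (Θ ×ˢ (univ : Set F)) := h.isOpen.prod isOpen_univ
  obtain ⟨q, hq, hlim⟩ := mem_closure_iff_seq_limit.1 hL
  rw [nhds_prod_eq, tendsto_prod_iff'] at hlim
  obtain ⟨hlim₁, hlim₂⟩ := hlim
  have hqΘ (k : ℕ) : (q k).1 ∈ Θ := (hq k).1
  have hex (k : ℕ) := (mem_solutionJacobian_iff hinv (hqΘ k)).1 (hq k).2
  choose D hD K hK hDK using hex
  have hlimΘ : Tendsto (fun k => (q k).1) atTop (𝓝[Θ] θ) :=
    tendsto_nhdsWithin_iff.2 ⟨hlim₁, Eventually.of_forall hqΘ⟩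
  have hproper : ProperSpace (E × F →L[ℝ] F) := FiniteDimensional.proper ℝ (E × F →L[ℝ] F)
  obtain ⟨C, hC⟩ := h.eventually_jac_mem_closedBall hc hθ
  have hev : ∀ᶠ k in atTop, (D k, K k) ∈ Metric.closedBall (0 : E × F →L[ℝ] F) C ×ˢ
      Metric.closedBall (0 : E × F →L[ℝ] F) C :=
    (hlimΘ.eventually hC).mono fun k hk => hk _ (hD k) _ (hK k)
  obtain ⟨⟨D₀, K₀⟩, -, φ, hφ, hφlim⟩ := ((isCompact_closedBall (0 : E × F →L[ℝ] F) C).prod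
    (isCompact_closedBall (0 : E × F →L[ℝ] F) C)).tendsto_subseq' hev.frequently
  have hφD : Tendsto (fun k => D (φ k)) atTop (𝓝 D₀) := (continuous_fst.tendsto _).comp hφlim
  have hφK : Tendsto (fun k => K (φ k)) atTop (𝓝 K₀) := (continuous_snd.tendsto _).comp hφlim
  have hφΘ := hlimΘ.comp hφ.tendsto_atTop
  refine (mem_solutionJacobian_iff hinv hθ).2 ⟨D₀, ?_, K₀, ?_, ?_⟩
  · refine (hasLocallyCompactGraphOn_clarkeJacobian hopen
      h.pathDifferentiable_T.1).mem_of_mem_closure (x := forwardMap γ B (θ, xs θ))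
      ⟨hθ, mem_univ _⟩ ?_
    refine mem_closure_of_tendsto
      (((h.continuousOn_forwardMap_solution hc θ hθ).tendsto.comp hφΘ).prodMk_nhds hφD)
      (Eventually.of_forall fun k => ?_)
    exact ⟨⟨hqΘ _, mem_univ _⟩, hD (φ k)⟩
  · refine (hasLocallyCompactGraphOn_clarkeJacobian hopen
      h.pathDifferentiable_B.1).mem_of_mem_closure (x := (θ, xs θ)) ⟨hθ, mem_univ _⟩ ?_
    refine mem_closure_of_tendsto
      ((((continuousOn_id.prodMk hc) θ hθ).tendsto.comp hφΘ).prodMk_nhds hφK)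
      (Eventually.of_forall fun k => ?_)
    exact ⟨⟨hqΘ _, mem_univ _⟩, hK (φ k)⟩
  · exact (isClosed_setOf_linearSystem γ).mem_of_tendsto
      (hφlim.prodMk_nhds (hlim₂.comp hφ.tendsto_atTop))
      (Eventually.of_forall fun k => hDK (φ k))

theorem StandingAssumption.isConservativeJacobianOn_solutionJacobian
    (h : StandingAssumption Θ A B γ) (hlip : LocallyLipschitzOn Θ xs)
    (hxs : ∀ θ ∈ Θ, xs θ ∈ solutionSet A B θ) {κ : ℝ} (hκ : κ < 1)
    (hP : ∀ θ ∈ Θ, ∀ D ∈ jacT γ A B θ (xs θ), ∀ K ∈ jacB B θ (xs θ),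
      ∀ v, ‖partialx γ D K v‖ ≤ κ * ‖v‖) :
    IsConservativeJacobianOn (solutionJacobian γ A B xs) xs Θ := by
  have hopen : IsOpen (Θ ×ˢ (univ : Set F)) := h.isOpen.prod isOpen_univ
  have hinv : ∀ θ ∈ Θ, ∀ D ∈ jacT γ A B θ (xs θ), ∀ K ∈ jacB B θ (xs θ),
      (ContinuousLinearMap.id ℝ F - partialx γ D K).IsInvertible :=
    fun θ hθ D hD K hK => isInvertible_id_sub hκ (hP θ hθ D hD K hK)
  refine ⟨fun θ hθ => ?_,
    fun θ hθ => h.solutionJacobian_locallyBounded hlip.continuousOn hκ hinv hP hθ,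
    fun θ hθ L hL => h.solutionJacobian_graphClosed hlip.continuousOn hinv hθ hL,
    fun c hc hcΘ => ?_⟩
  · obtain ⟨D, hD⟩ := clarkeJacobian_nonempty hopen h.pathDifferentiable_T.1
      (x := forwardMap γ B (θ, xs θ)) ⟨hθ, mem_univ _⟩
    obtain ⟨K, hK⟩ := clarkeJacobian_nonempty hopen h.pathDifferentiable_B.1
      (x := (θ, xs θ)) ⟨hθ, mem_univ _⟩
    exact ⟨_, D, hD, K, hK, rfl⟩
  · filter_upwards [h.ae_deriv_solution_eq hlip hxs hc hcΘ, ae_restrict_mem measurableSet_Icc]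
      with t ⟨y', hy', ht⟩ htI M hM
    obtain ⟨D, hD, K, hK, hM⟩ := (mem_solutionJacobian_iff hinv (hcΘ htI)).1 hM
    have heq : M (deriv c t) = y' := by
      refine (hinv _ (hcΘ htI) D hD K hK).injective ?_
      have h1 : (ContinuousLinearMap.id ℝ F - partialx γ D K) (M (deriv c t)) =
        partialθ γ D K (deriv c t) := congrArg (fun L => L (deriv c t)) hM
      rw [h1]
      simp only [sub_apply, ContinuousLinearMap.id_apply]
      exact eq_sub_of_add_eq' (ht D hD K hK)
    rwa [heq]

/-- The statement on the implicit differentiation of solutions, for general finite-dimensional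
spaces of parameters and unknowns. -/
theorem StandingAssumption.contractive_and_pathDifferentiable {α β : ℝ} (hα : 0 < α) (hβ : 0 < β)
    (hass : StandingAssumption Θ A B γ)
    (hLip : ∀ θ ∈ Θ, ∀ x y, ‖B θ x - B θ y‖ ≤ β * ‖x - y‖)
    (hstrong : (∀ θ ∈ Θ, MonotoneWith α (A θ)) ∨
      (∀ θ ∈ Θ, MonotoneWith α (singleValued (B θ))))
    (hγ : γ < 2 * α / (α + β) ^ 2) :
    ResidualContractive Θ γ A B ∧
    (∀ θ ∈ Θ, ∃! x, x ∈ solutionSet A B θ) ∧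
    ∀ xs : E → F, (∀ θ ∈ Θ, xs θ ∈ solutionSet A B θ) →
      PathDifferentiableOn xs Θ ∧
      (∀ θ ∈ Θ, ∀ D ∈ jacT γ A B θ (xs θ), ∀ K ∈ jacB B θ (xs θ),
        (ContinuousLinearMap.id ℝ F - partialx γ D K).IsInvertible) ∧
      IsConservativeJacobianOn (solutionJacobian γ A B xs) xs Θ := by
  obtain ⟨κ₁, κ₂, hκ₁, hκ₂, hκ, hT, hB⟩ :=
    exists_contraction_constants hα hβ hass hLip hstrong hγ
  have hP {θ : E} (hθ : θ ∈ Θ) (x : F) :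
      ∀ D ∈ jacT γ A B θ x, ∀ K ∈ jacB B θ x,
        ∀ v, ‖partialx γ D K v‖ ≤ κ₁ * κ₂ * ‖v‖ :=
    fun D hD K hK v => norm_partialx_apply_le hass.isOpen hκ₁ hT hB hθ hD hK v
  refine ⟨fun θ hθ => ?_, fun θ hθ => ?_, fun xs hxs => ?_⟩
  · obtain ⟨x, hx⟩ := hass.solution_nonempty θ hθ
    refine ⟨x, hx, ?_⟩
    refine lt_of_le_of_lt (b := ENNReal.ofReal (κ₁ * κ₂)) (iSup₂_le ?_) ?_
    · rintro _ ⟨D, hD, K, hK, rfl⟩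
      rw [← ofReal_norm]
      exact ENNReal.ofReal_le_ofReal (ContinuousLinearMap.opNorm_le_bound _ (by positivity)
        (hP hθ x D hD K hK))
    · rw [ENNReal.ofReal_lt_one]
      exact hκ
  · obtain ⟨x, hx⟩ := hass.solution_nonempty θ hθ
    exact ⟨x, hx, fun y hy => hass.solution_unique hκ₁ hκ hT hB hθ hy hx⟩
  · have hlip := hass.locallyLipschitzOn_solution hκ₁ hκ hT hB hxs
    have hJ := hass.isConservativeJacobianOn_solutionJacobian hlip hxs hκ
      fun θ hθ => hP hθ (xs θ)
    exact ⟨⟨hlip, _, hJ⟩, fun θ hθ D hD K hK =>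
      isInvertible_id_sub hκ (hP hθ (xs θ) D hD K hK), hJ⟩

end Solution

end MonoIncl

theorem theorem3p4 (p n : ℕ)
    (Θ : Set (EuclideanSpace ℝ (Fin p)))
    (A : EuclideanSpace ℝ (Fin p) → EuclideanSpace ℝ (Fin n) → Set (EuclideanSpace ℝ (Fin n)))
    (B : EuclideanSpace ℝ (Fin p) → EuclideanSpace ℝ (Fin n) → EuclideanSpace ℝ (Fin n))
    (γ α β : ℝ) (hα : 0 < α) (hβ : 0 < β)
    (hass : MonoIncl.StandingAssumption Θ A B γ)
    (hLip : ∀ θ ∈ Θ, ∀ x y, ‖B θ x - B θ y‖ ≤ β * ‖x - y‖)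
    (hstrong : (∀ θ ∈ Θ, MonoIncl.MonotoneWith α (A θ)) ∨
      (∀ θ ∈ Θ, MonoIncl.MonotoneWith α (MonoIncl.singleValued (B θ))))
    (hγ : γ ∈ Ioo 0 (2 * α / (α + β) ^ 2)) :
    MonoIncl.ResidualContractive Θ γ A B ∧
    (∀ θ ∈ Θ, ∃! x, x ∈ MonoIncl.solutionSet A B θ) ∧
    ∀ xs : EuclideanSpace ℝ (Fin p) → EuclideanSpace ℝ (Fin n),
      (∀ θ ∈ Θ, xs θ ∈ MonoIncl.solutionSet A B θ) →
      MonoIncl.PathDifferentiableOn xs Θ ∧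
      (∀ θ ∈ Θ, ∀ D ∈ MonoIncl.jacT γ A B θ (xs θ), ∀ K ∈ MonoIncl.jacB B θ (xs θ),
        (ContinuousLinearMap.id ℝ (EuclideanSpace ℝ (Fin n)) -
          MonoIncl.partialx γ D K).IsInvertible) ∧
      MonoIncl.IsConservativeJacobianOn (MonoIncl.solutionJacobian γ A B xs) xs Θ := by
  exact hass.contractive_and_pathDifferentiable hα hβ hLip hstrong hγ.2
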